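/- A layered tree is a finite rooted tree with nonnegative real edge lengths; its root is the source, its $i$-th layer is the (nonempty) set of nodes at combinatorial depth $i$, and its target is a node of the last layer. In layered tree traversal a searcher starts at the source; at step $i$ the $i$-th layer is revealed together with the edges (and their lengths) that join it to layer $i-1$, and the searcher must move to a node of layer $i$ along revealed edges; after the last layer is revealed it moves to the target. A deterministic algorithm maps the sequence of revealed layers and the position of the searcher in the last but one layer to its position in the last layer, and its cost $\mathrm{Cost}(\mathcal A,T)$ is the total length traversed until the target is attained. A randomized algorithm is a probability distribution over deterministic algorithms. There exist randomized algorithms $\{\mathcal{A}_k\}_{k\ge 1}$ for layered tree traversal and an absolute constant $C$ such that for every $k\ge 1$ and every layered tree $T$, $$\mathbb{E}\big(\mathrm{Cost}(\mathcal{A}_k,T)\big)\le \frac{2L}{k}+C\,kD,$$ where $L$ is the sum of all edge lengths of $T$ and $D$ is the distance from the source to the target. Moreover, there is an absolute constant $C'$ such that for every $w\ge 1$ and every layered tree $T$ all of whose edges have length $1$ and all of whose layers have at most $w$ nodes, the choice $k=\lfloor\sqrt{w}\rfloor$ gives $$\mathbb{E}\big(\mathrm{Cost}(\mathcal{A}_{\lfloor\sqrt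 w\rfloor},T)\big)\le C'\sqrt{w}\,D.$$ -/

import Mathlib

open MeasureTheory
open scoped NNReal

/-- A (revealed prefix of a) finite layered tree with nonnegative real edge lengths, presented layer
by layer; the index is the number of nodes of the last layer. Layer `0` consists of the source.
A further layer consists of `n ≥ 1` nodes, each joined by one edge to its parent in the preceding
layer. Nodes of a layer may be childless, and edges of length `0` are allowed. -/
inductive LayeredTree : ℕ → Type
  | source : LayeredTree 1
  | addLayer {m : ℕ} (T : LayeredTree m) (n : ℕ) (hn : 0 < n) (parent : Fin n → Fin m)
      (len : Fin n → ℝ≥0) : LayeredTree n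

namespace LayeredTree

/-- The sum of all edge lengths. -/
noncomputable def length : {m : ℕ} → LayeredTree m → ℝ
  | _, source => 0
  | _, addLayer T _ _ _ len => T.length + ∑ v, (len v : ℝ)

/-- The maximum number of nodes of a layer. -/
def width : {m : ℕ} → LayeredTree m → ℕ
  | _, source => 1
  | _, addLayer T n _ _ _ => max T.width n

/-- All edges have length `1`. -/
def UnitLengths : {m : ℕ} → LayeredTree m → Prop
  | _, source => True
  | _, addLayer T _ _ _ len => T.UnitLengths ∧ ∀ v, len v = 1

/-- The distance from the source to a node of the last layer. -/
noncomputable def depth : {m : ℕ} → LayeredTree m → Fin m → ℝ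
  | _, source, _ => 0
  | _, addLayer T _ _ parent len, v => T.depth (parent v) + len v

/-- The tree distance between two nodes of the last layer: the total length of the edges that lead
from either node up to their lowest common ancestor. -/
noncomputable def dist : {m : ℕ} → LayeredTree m → Fin m → Fin m → ℝ
  | _, source, _, _ => 0
  | _, addLayer T _ _ parent len, u, v =>
      if u = v then 0 else len u + T.dist (parent u) (parent v) + len v

/-- What a searcher faces at one step: the layers `tree` revealed so far, the position `pos` of the
searcher in the last of them, and the newly revealed layer with its edges. -/
structure Situation where
  m : ℕ
  tree : LayeredTree m
  pos : Fin m
  n : ℕ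
  hn : 0 < n
  parent : Fin n → Fin m
  len : Fin n → ℝ≥0

/-- A deterministic algorithm for layered tree traversal: it maps the sequence of revealed layers and
the position of the searcher in the last but one layer to a position in the last layer. -/
def DetAlgorithm : Type := (s : Situation) → Fin s.n

/-- The product σ-algebra (each `Fin n` being discrete). -/
instance : MeasurableSpace DetAlgorithm :=
  inferInstanceAs (MeasurableSpace ((s : Situation) → Fin s.n))

/-- A randomized algorithm is a probability distribution over deterministic algorithms. -/
abbrev RandAlgorithm : Type := ProbabilityMeasure DetAlgorithm

/-- The position, in the last layer, of a searcher that starts at the source and follows `A`. -/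
def position (A : DetAlgorithm) : {m : ℕ} → (T : LayeredTree m) → Fin m
  | _, source => 0
  | _, addLayer (m := m) T n hn parent len =>
      A { m := m, tree := T, pos := position A T, n := n, hn := hn, parent := parent, len := len }

/-- The distance travelled by the searcher until it has moved to the last layer. In each step it
moves from its position `x` to a node `v` of the next layer; the path from `x` to `v` ends with the
edge from the parent of `v` to `v`. -/
noncomputable def travelled (A : DetAlgorithm) : {m : ℕ} → LayeredTree m → ℝ
  | _, source => 0
  | _, addLayer T n hn parent len =>
      travelled A T
        + (T.dist (position A T) (parent (position A (addLayer T n hn parent len)))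
          + len (position A (addLayer T n hn parent len)))

/-- The cost of `A` on the layered tree `T` with target `t` in the last layer: the total distance
travelled by the searcher to attain the target. (The last step is void if the last layer is `{t}`.) -/
noncomputable def cost (A : DetAlgorithm) {m : ℕ} (T : LayeredTree m) (t : Fin m) : ℝ :=
  travelled A T + T.dist (position A T) t

end LayeredTree

/-!
Distribute the searcher over the last layer `S` according to the unit electrical flow from the
source to `S`, where an edge is a resistor whose resistance is its length. When a new layer is
revealed, erase the childless nodes of `S` one by one and then extend the flow to the new layer. In
both cases the distance that mass has to move upwards, measured against the lengths of the edges,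
is at most a constant times the increase of the potential
`∑ len e * √(x e) / √κ + (2 * L - ℓ) / κ + κ * V`, where `x` is the flow, `ℓ` the length of its
support, `V` the voltage of the source, and `κ > 0` is arbitrary. In the end
`∑ len e * √(x e) / √κ` is at most `L / κ + ∑ len e * x e`, the flow travels
`∑ len e * x e ≤ L / κ + κ * V`, and `V ≤ D` by Thomson's principle; hence the total distance is
`O(L / κ + κ * D)`. Since the flow is independent of `κ`, one may take `κ = √(L / D)` after the
fact and obtain a bound of `O(√(L * D))`.

Edges of length `0` can short-circuit others and leave nodes of `S` without flow. All lengths are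
therefore increased by `ε > 0` first, and an ultrafilter limit as `ε` tends to `0` recovers the
original lengths. Finally, a searcher that moves independently in each situation, with the
transition probabilities of an optimal transport plan, realizes the evolving distribution at the
same expected cost.
-/

namespace LayeredTree

open Finset Filter Topology ProbabilityTheory

section Push

variable {α β M N : Type*} [AddCommMonoid M] [AddCommMonoid N]

/-- The distribution of mass on a layer that arises from the distribution `x` on the next layer when
all mass moves up to the parents. -/
noncomputable abbrev push [Finite α] [Finite β] (parent : α → β) (x : α → M) : β → M :=
  FunOnFinite.map parent x

lemma push_apply [Fintype α] [Finite β] [DecidableEq β] (parent : α → β) (x : α → M) (p : β) :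
    push parent x p = ∑ v with parent v = p, x v :=
  FunOnFinite.map_apply_apply parent x p

lemma push_comp [Finite α] [Finite β] (φ : M →+ N) (parent : α → β) (x : α → M) :
    push parent (fun v => φ (x v)) = fun p => φ (push parent x p) := by
  classical
  cases nonempty_fintype α
  funext p
  simp only [push_apply, map_sum]

lemma push_prodMk [Finite α] [Finite β] (parent : α → β) (x : α → M) (y : α → N) :
    push parent (fun v => (x v, y v)) = fun p => (push parent x p, push parent y p) := by
  classical
  cases nonempty_fintype α
  funext p
  simp only [push_apply, Prod.ext_iff, Prod.fst_sum, Prod.snd_sum, and_self]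

lemma sum_push [Fintype α] [Fintype β] (parent : α → β) (x : α → M) :
    ∑ p, push parent x p = ∑ v, x v := by
  classical
  simp only [push_apply]
  exact sum_fiberwise univ parent x

lemma sum_push_mul [Fintype α] [Fintype β] (parent : α → β) (x : α → ℝ) (g : β → ℝ) :
    ∑ p, push parent x p * g p = ∑ v, x v * g (parent v) := by
  classical
  rw [← sum_fiberwise univ parent]
  refine sum_congr rfl fun p _ => ?_
  rw [push_apply, sum_mul]
  exact sum_congr rfl fun v hv => by rw [(mem_filter.1 hv).2]

variable [Finite α] [Finite β]

lemma push_nonneg [PartialOrder M] [IsOrderedAddMonoid M] (parent : α → β) {x : α → M}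
    (hx : ∀ v, 0 ≤ x v) (p : β) : 0 ≤ push parent x p := by
  classical
  cases nonempty_fintype α
  exact push_apply parent x p ▸ sum_nonneg fun v _ => hx v

lemma le_push [PartialOrder M] [IsOrderedAddMonoid M] (parent : α → β) {x : α → M}
    (hx : ∀ v, 0 ≤ x v) (v : α) : x v ≤ push parent x (parent v) := by
  classical
  cases nonempty_fintype α
  exact push_apply parent x _ ▸ single_le_sum (f := x) (fun v _ => hx v) (by simp)

variable [DecidableEq β] {S : Finset α}

lemma push_apply_eq_sum_filter (parent : α → β) {x : α → M} (hx : ∀ v ∉ S, x v = 0) (p : β) :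
    push parent x p = ∑ v ∈ S with parent v = p, x v := by
  cases nonempty_fintype α
  rw [push_apply]
  refine (sum_subset (filter_subset_filter _ (subset_univ S)) fun v hv hv' =>
    hx v fun hvS => ?_).symm
  exact hv' (mem_filter.2 ⟨hvS, (mem_filter.1 hv).2⟩)

lemma push_eq_zero (parent : α → β) {x : α → M} (hx : ∀ v ∉ S, x v = 0) {p : β}
    (hp : p ∉ S.image parent) : push parent x p = 0 := by
  rw [push_apply_eq_sum_filter parent hx, filter_false_of_mem, sum_empty]
  rintro v hv rfl
  exact hp (mem_image_of_mem parent hv)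

end Push

section EdgeSum

variable {M N : Type*} [AddCommMonoid M] [AddCommMonoid N]

/-- The sum over all edges `e` of `len e * f (x e)`, where `x e` is the mass that the distribution
`x` on the last layer puts below `e`, that is, the flow through `e` from the source to `x`. -/
noncomputable def edgeSum (f : M → ℝ) : {m : ℕ} → LayeredTree m → (Fin m → M) → ℝ
  | _, source, _ => 0
  | _, addLayer T _ _ parent len, x =>
      edgeSum f T (push parent x) + ∑ v, (len v : ℝ) * f (x v)

lemma edgeSum_comp (f : N → ℝ) (φ : M →+ N) {m : ℕ} (T : LayeredTree m) (x : Fin m → M) :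
    edgeSum f T (fun v => φ (x v)) = edgeSum (fun a => f (φ a)) T x := by
  induction T with
  | source => rfl
  | addLayer T _ _ parent len ih => rw [edgeSum, edgeSum, push_comp, ih]

lemma edgeSum_fst (f : M → ℝ) {m : ℕ} (T : LayeredTree m) (x : Fin m → M) (y : Fin m → N) :
    edgeSum (fun p => f p.1) T (fun v => (x v, y v)) = edgeSum f T x :=
  (edgeSum_comp f (AddMonoidHom.fst M N) T fun v => (x v, y v)).symm

lemma edgeSum_snd (f : N → ℝ) {m : ℕ} (T : LayeredTree m) (x : Fin m → M) (y : Fin m → N) :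
    edgeSum (fun p => f p.2) T (fun v => (x v, y v)) = edgeSum f T y :=
  (edgeSum_comp f (AddMonoidHom.snd M N) T fun v => (x v, y v)).symm

lemma edgeSum_swap (f : M × N → ℝ) {m : ℕ} (T : LayeredTree m) (x : Fin m → M) (y : Fin m → N) :
    edgeSum f T (fun v => (x v, y v)) = edgeSum (fun p => f p.swap) T (fun v => (y v, x v)) :=
  edgeSum_comp f (AddEquiv.prodComm (M := N) (N := M)).toAddMonoidHom T fun v => (y v, x v)

lemma edgeSum_diag (f : M × M → ℝ) {m : ℕ} (T : LayeredTree m) (x : Fin m → M) :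
    edgeSum f T (fun v => (x v, x v)) = edgeSum (fun a => f (a, a)) T x :=
  edgeSum_comp f ((AddMonoidHom.id M).prod (AddMonoidHom.id M)) T x

lemma edgeSum_sub_apply {G : Type*} [AddCommGroup G] (f : G → ℝ) {m : ℕ} (T : LayeredTree m)
    (x y : Fin m → G) :
    edgeSum f T (fun v => x v - y v) = edgeSum (fun p => f (p.1 - p.2)) T (fun v => (x v, y v)) :=
  edgeSum_comp f (AddMonoidHom.fst G G - AddMonoidHom.snd G G) T fun v => (x v, y v)

lemma edgeSum_add (f g : M → ℝ) {m : ℕ} (T : LayeredTree m) (x : Fin m → M) :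
    edgeSum (fun a => f a + g a) T x = edgeSum f T x + edgeSum g T x := by
  induction T with
  | source => simp [edgeSum]
  | addLayer T _ _ parent len ih =>
    simp only [edgeSum, ih, mul_add, sum_add_distrib]
    ring

lemma edgeSum_const_mul (c : ℝ) (f : M → ℝ) {m : ℕ} (T : LayeredTree m) (x : Fin m → M) :
    edgeSum (fun a => c * f a) T x = c * edgeSum f T x := by
  induction T with
  | source => simp [edgeSum]
  | addLayer T _ _ parent len ih => simp only [edgeSum, ih, mul_add, mul_sum, mul_left_comm]

lemma edgeSum_sub (f g : M → ℝ) {m : ℕ} (T : LayeredTree m) (x : Fin m → M) :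
    edgeSum (fun a => f a - g a) T x = edgeSum f T x - edgeSum g T x :=
  eq_sub_of_add_eq (by simp only [← edgeSum_add, sub_add_cancel])

lemma edgeSum_one {m : ℕ} (T : LayeredTree m) (x : Fin m → M) :
    edgeSum (fun _ => 1) T x = T.length := by
  induction T with
  | source => rfl
  | addLayer T _ _ parent len ih => simp [edgeSum, length, ih]

lemma edgeSum_nonneg {f : M → ℝ} (hf : ∀ a, 0 ≤ f a) {m : ℕ} (T : LayeredTree m) (x : Fin m → M) :
    0 ≤ edgeSum f T x := by
  induction T with
  | source => exact le_rfl
  | addLayer T _ _ parent len ih =>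
    exact add_nonneg (ih _) (sum_nonneg fun v _ => mul_nonneg (len v).2 (hf _))

lemma edgeSum_zero {f : M → ℝ} (hf : f 0 = 0) {m : ℕ} (T : LayeredTree m) :
    edgeSum f T (fun _ => 0) = 0 := by
  have := edgeSum_comp f (0 : M →+ M) T fun _ => 0
  simp only [AddMonoidHom.zero_apply, hf] at this
  simpa [this] using edgeSum_const_mul 0 (fun _ : M => 0) T fun _ => 0

lemma edgeSum_add_apply_le {f : M → ℝ} (hf : ∀ a b, f (a + b) ≤ f a + f b) {m : ℕ}
    (T : LayeredTree m) (x y : Fin m → M) :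
    edgeSum f T (fun v => x v + y v) ≤ edgeSum f T x + edgeSum f T y := by
  have hcomp := edgeSum_comp f (AddMonoidHom.fst M M + AddMonoidHom.snd M M) T fun v => (x v, y v)
  simp only [AddMonoidHom.add_apply, AddMonoidHom.coe_fst, AddMonoidHom.coe_snd] at hcomp
  rw [hcomp, ← edgeSum_fst f T x y, ← edgeSum_snd f T x y, ← edgeSum_add, ← sub_nonneg,
    ← edgeSum_sub]
  exact edgeSum_nonneg (fun p => sub_nonneg.2 (hf _ _)) T _

lemma edgeSum_mono [PartialOrder M] [IsOrderedAddMonoid M] {f g : M → ℝ}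
    (hfg : ∀ a, 0 ≤ a → f a ≤ g a) {m : ℕ} (T : LayeredTree m) {x : Fin m → M}
    (hx : ∀ v, 0 ≤ x v) : edgeSum f T x ≤ edgeSum g T x := by
  induction T with
  | source => exact le_rfl
  | addLayer T _ _ parent len ih =>
    exact add_le_add (ih (push_nonneg parent hx))
      (sum_le_sum fun v _ => mul_le_mul_of_nonneg_left (hfg _ (hx v)) (len v).2)

lemma edgeSum_single {f : M → ℝ} (hf : f 0 = 0) {m : ℕ} (T : LayeredTree m) (t : Fin m) (a : M) :
    edgeSum f T (Pi.single t a) = T.depth t * f a := by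
  induction T with
  | source => simp [edgeSum, depth]
  | addLayer T _ _ parent len ih =>
    have hlayer : ∀ v, (len v : ℝ) * f (Pi.single (M := fun _ => M) t a v)
        = if v = t then (len t : ℝ) * f a else 0 := fun v => by
      split_ifs with h
      · rw [h, Pi.single_eq_same]
      · rw [Pi.single_eq_of_ne h, hf, mul_zero]
    rw [edgeSum, push, FunOnFinite.map_piSingle, ih, depth, add_mul]
    simp [hlayer]

end EdgeSum

/-! ### Electrical flows -/

/-- All edge lengths are positive. -/
def PosLengths : {m : ℕ} → LayeredTree m → Prop
  | _, source => True
  | _, addLayer T _ _ _ len => T.PosLengths ∧ ∀ v, 0 < len v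

/-- The length of the part of the tree that carries the flow `x`. -/
noncomputable def supportLength {m : ℕ} (T : LayeredTree m) (x : Fin m → ℝ) : ℝ :=
  edgeSum (fun a => if a = 0 then 0 else 1) T x

/-- `x` is a unit electrical flow from the source to the set `S` of nodes of the last layer, where
each edge has its length as resistance, `U` is the voltage on `S`, relative to some common ground,
and `V` is the voltage of the source. -/
def IsElectric : {m : ℕ} → LayeredTree m → Finset (Fin m) → (Fin m → ℝ) → (Fin m → ℝ) → ℝ → Prop
  | _, source, S, x, U, V => 0 ∈ S ∧ x 0 = 1 ∧ 0 ≤ U 0 ∧ U 0 = V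
  | _, addLayer T _ _ parent len, S, x, U, V =>
      (∀ v ∈ S, 0 < x v ∧ 0 ≤ U v) ∧ (∀ v ∉ S, x v = 0) ∧
        ∃ U₀, IsElectric T (S.image parent) (push parent x) U₀ V ∧
          ∀ v ∈ S, U₀ (parent v) = U v + len v * x v

/-- No node of `S` has a larger effective resistance `U v / x v` to the ground under the flow `x`
with voltage `U` than under the flow `x'` with voltage `U'`. -/
def ResistanceLE {m : ℕ} (S : Finset (Fin m)) (x U x' U' : Fin m → ℝ) : Prop :=
  ∀ v ∈ S, U v * x' v ≤ U' v * x v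

/-- The parallel connection of larger resistances is larger. -/
lemma ResistanceLE.push_parent {m n : ℕ} {parent : Fin n → Fin m} {len : Fin n → ℝ≥0}
    {S : Finset (Fin n)} {x U x' U' : Fin n → ℝ} {U₀ U₀' : Fin m → ℝ}
    (hR : ResistanceLE S x U x' U')
    (hx : ∀ v ∉ S, x v = 0) (hx' : ∀ v ∉ S, x' v = 0)
    (hU : ∀ v ∈ S, U₀ (parent v) = U v + len v * x v)
    (hU' : ∀ v ∈ S, U₀' (parent v) = U' v + len v * x' v) :
    ResistanceLE (S.image parent) (push parent x) U₀ (push parent x') U₀' := by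
  intro p _
  rw [push_apply_eq_sum_filter parent hx, push_apply_eq_sum_filter parent hx', mul_sum, mul_sum]
  refine sum_le_sum fun v hv => ?_
  obtain ⟨hvS, rfl⟩ := mem_filter.1 hv
  rw [hU v hvS, hU' v hvS]
  linarith [hR v hvS]

/-- A nonnegative weight `ω x x'` of edges that carry the flow `x` before and `x'` after a change,
such that merging edges does not produce an edge of larger weight. -/
structure IsMaxSubadditive (ω : ℝ → ℝ → ℝ) : Prop where
  nonneg : ∀ a b, 0 ≤ ω a b
  add_le : ∀ a b a' b', 0 < a → 0 < b → 0 < a' → 0 < b' →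
    ω (a + b) (a' + b') ≤ max (ω a a') (ω b b')

lemma IsMaxSubadditive.exists_sum_le {ω : ℝ → ℝ → ℝ} (hω : IsMaxSubadditive ω) {ι : Type*}
    {s : Finset ι} (hs : s.Nonempty) {x x' : ι → ℝ} (hx : ∀ i ∈ s, 0 < x i)
    (hx' : ∀ i ∈ s, 0 < x' i) : ∃ i ∈ s, ω (∑ j ∈ s, x j) (∑ j ∈ s, x' j) ≤ ω (x i) (x' i) := by
  induction hs using Finset.Nonempty.cons_induction with
  | singleton i => exact ⟨i, mem_singleton_self i, by simp⟩
  | cons i s hi hs ih =>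
    simp only [forall_mem_cons] at hx hx'
    obtain ⟨j, hj, hle⟩ := ih hx.2 hx'.2
    have hmerge := hω.add_le _ _ _ _ hx.1 (sum_pos hx.2 hs) hx'.1 (sum_pos hx'.2 hs)
    rw [sum_cons, sum_cons]
    rcases le_max_iff.1 hmerge with h | h
    · exact ⟨i, mem_cons_self i s, h⟩
    · exact ⟨j, mem_cons_of_mem hj, h.trans hle⟩

lemma sum_image_mul_le {α β : Type*} [DecidableEq β] {f : α → β} {s : Finset α} {ω : α → ℝ}
    {Ω Δ : β → ℝ} (hω : ∀ a ∈ s, 0 ≤ ω a) (hΔ : ∀ b ∈ s.image f, 0 ≤ Δ b)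
    (h : ∀ b ∈ s.image f, ∃ a ∈ s, f a = b ∧ Ω b ≤ ω a) :
    ∑ b ∈ s.image f, Ω b * Δ b ≤ ∑ a ∈ s, ω a * Δ (f a) := by
  rw [← sum_fiberwise_of_maps_to fun a ha => mem_image_of_mem f ha]
  refine sum_le_sum fun b hb => ?_
  obtain ⟨a, ha, rfl, hle⟩ := h b hb
  refine (mul_le_mul_of_nonneg_right hle (hΔ _ hb)).trans ?_
  refine single_le_sum (f := fun a => ω a * Δ (f a)) (fun c hc => ?_) (mem_filter.2 ⟨ha, rfl⟩)
  have hcs := (mem_filter.1 hc).1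
  exact mul_nonneg (hω c hcs) (hΔ _ (mem_image_of_mem f hcs))

lemma IsMaxSubadditive.exists_push_le {ω : ℝ → ℝ → ℝ} (hω : IsMaxSubadditive ω) {m n : ℕ}
    {parent : Fin n → Fin m} {S : Finset (Fin n)} {x x' : Fin n → ℝ} (hx : ∀ v ∉ S, x v = 0)
    (hx' : ∀ v ∉ S, x' v = 0) (hpos : ∀ v ∈ S, 0 < x v) (hpos' : ∀ v ∈ S, 0 < x' v) {p : Fin m}
    (hp : p ∈ S.image parent) :
    ∃ v ∈ S, parent v = p ∧ ω (push parent x p) (push parent x' p) ≤ ω (x v) (x' v) := by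
  obtain ⟨v, hv, hle⟩ := hω.exists_sum_le (s := {v ∈ S | parent v = p}) (x := x) (x' := x')
    (by simpa [filter_nonempty_iff] using hp) (fun v hv => hpos v (mem_filter.1 hv).1)
    (fun v hv => hpos' v (mem_filter.1 hv).1)
  obtain ⟨hvS, hvp⟩ := mem_filter.1 hv
  rw [push_apply_eq_sum_filter parent hx, push_apply_eq_sum_filter parent hx']
  exact ⟨v, hvS, hvp, hle⟩

lemma isMaxSubadditive_indicator :
    IsMaxSubadditive fun a a' => if a' < a then 1 else 0 where
  nonneg a a' := by split_ifs <;> norm_num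
  add_le a b a' b' _ _ _ _ := by
    rcases lt_or_ge a' a with ha | ha
    · exact le_max_of_le_left (by rw [if_pos ha]; split_ifs <;> norm_num)
    · refine le_max_of_le_right ?_
      rcases lt_or_ge b' b with hb | hb
      · rw [if_pos hb]; split_ifs <;> norm_num
      · rw [if_neg (not_lt.2 (add_le_add ha hb)), if_neg hb.not_gt]

/-- The slope of the chord of the square root between `a` and `b`, in a form that is also meaningful
for `a = b`. -/
noncomputable def sqrtSlope (a b : ℝ) : ℝ := 1 / (√a + √b)

lemma sqrtSlope_nonneg (a b : ℝ) : 0 ≤ sqrtSlope a b := by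
  unfold sqrtSlope; positivity

lemma sqrtSlope_mul_sub {a b : ℝ} (ha : 0 ≤ a) (hb : 0 ≤ b) :
    sqrtSlope a b * (a - b) = √a - √b := by
  have hfactor : (√a - √b) * (√a + √b) = a - b := by
    linear_combination Real.sq_sqrt ha - Real.sq_sqrt hb
  rcases (add_nonneg a.sqrt_nonneg b.sqrt_nonneg).eq_or_lt with h0 | hpos
  · rw [← hfactor, ← h0]
    linarith [a.sqrt_nonneg, b.sqrt_nonneg]
  · rw [sqrtSlope, ← hfactor]
    field_simp

lemma sqrtSlope_anti {a b a' b' : ℝ} (ha : 0 < a) (haa' : a ≤ a') (hbb' : b ≤ b') :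
    sqrtSlope a' b' ≤ sqrtSlope a b := by
  have := Real.sqrt_pos.2 ha
  unfold sqrtSlope
  gcongr

lemma isMaxSubadditive_sqrtSlope : IsMaxSubadditive sqrtSlope where
  nonneg := sqrtSlope_nonneg
  add_le _ _ _ _ ha hb _ hb' := le_max_of_le_left
    (sqrtSlope_anti ha (le_add_of_nonneg_right hb.le) (le_add_of_nonneg_right hb'.le))

namespace IsElectric

variable {m : ℕ} {T : LayeredTree m} {S : Finset (Fin m)} {x U x' U' : Fin m → ℝ} {V V' : ℝ}

lemma pos (h : IsElectric T S x U V) {v : Fin m} (hv : v ∈ S) : 0 < x v := by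
  cases T with
  | source => exact Subsingleton.elim 0 v ▸ h.2.1 ▸ one_pos
  | addLayer => exact (h.1 v hv).1

lemma eq_zero (h : IsElectric T S x U V) {v : Fin m} (hv : v ∉ S) : x v = 0 := by
  cases T with
  | source => exact absurd (Subsingleton.elim v 0 ▸ h.1) hv
  | addLayer => exact h.2.1 v hv

lemma nonneg (h : IsElectric T S x U V) (v : Fin m) : 0 ≤ x v := by
  by_cases hv : v ∈ S
  · exact (h.pos hv).le
  · exact (h.eq_zero hv).ge

lemma voltage_nonneg (h : IsElectric T S x U V) {v : Fin m} (hv : v ∈ S) : 0 ≤ U v := by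
  cases T with
  | source => exact Subsingleton.elim 0 v ▸ h.2.2.1
  | addLayer => exact (h.1 v hv).2

lemma sum_eq_one (h : IsElectric T S x U V) : ∑ v, x v = 1 := by
  induction T with
  | source => simpa using h.2.1
  | addLayer T _ _ parent len ih =>
    obtain ⟨_, _, U₀, h₀, _⟩ := h
    exact sum_push parent x ▸ ih h₀

/-- Reciprocity of electrical flows. -/
lemma edgeSum_mul_add (h : IsElectric T S x U V) {y : Fin m → ℝ} (hy : ∀ v ∉ S, y v = 0)
    (hy₁ : ∑ v, y v = 1) :
    edgeSum (fun p => p.1 * p.2) T (fun v => (x v, y v)) + ∑ v, y v * U v = V := by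
  induction T with
  | source =>
    have : y 0 = 1 := by simpa using hy₁
    simp [edgeSum, this, h.2.2.2]
  | addLayer T _ _ parent len ih =>
    obtain ⟨_, _, U₀, h₀, hU⟩ := h
    have := ih h₀ (y := push parent y) (fun p hp => push_eq_zero parent hy hp)
      ((sum_push parent y).trans hy₁)
    rw [← this, sum_push_mul, edgeSum, push_prodMk, add_assoc, ← sum_add_distrib]
    congr 1
    refine sum_congr rfl fun v _ => ?_
    by_cases hv : v ∈ S
    · rw [hU v hv]; ring
    · rw [hy v hv]; ring

lemma supportLength_eq (h : IsElectric T S x U V) (h' : IsElectric T S x' U' V') :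
    T.supportLength x = T.supportLength x' := by
  unfold supportLength
  induction T with
  | source => rfl
  | addLayer T _ _ parent len ih =>
    obtain ⟨_, _, _, h₀, _⟩ := id h
    obtain ⟨_, _, _, h₀', _⟩ := id h'
    rw [edgeSum, edgeSum, ih h₀ h₀']
    congr 1
    refine sum_congr rfl fun v _ => ?_
    by_cases hv : v ∈ S
    · rw [if_neg (h.pos hv).ne', if_neg (h'.pos hv).ne']
    · rw [h.eq_zero hv, h'.eq_zero hv]

lemma voltage_mono (h : IsElectric T S x U V) (h' : IsElectric T S x' U' V')
    (hR : ResistanceLE S x U x' U') : ∀ v ∈ S, U v ≤ U' v := by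
  induction T with
  | source =>
    intro v hv
    obtain rfl := Subsingleton.elim v 0
    simpa [h.2.1, h'.2.1] using hR 0 hv
  | addLayer T _ _ parent len ih =>
    intro v hv
    have hpos := h.pos hv
    have hUv := h.voltage_nonneg hv
    obtain ⟨_, hx, U₀, h₀, hU⟩ := h
    obtain ⟨_, hx', U₀', h₀', hU'⟩ := h'
    have hparent := ih h₀ h₀' (hR.push_parent hx hx' hU hU') (parent v) (mem_image_of_mem _ hv)
    rw [hU v hv, hU' v hv] at hparent
    by_contra! hlt
    have hflow : x v < x' v := by
      by_contra! hle
      linarith [mul_le_mul_of_nonneg_left hle (len v).coe_nonneg]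
    nlinarith [hR v hv, mul_le_mul_of_nonneg_left hflow.le hUv]

lemma edgeSum_weight_mul_sub_le {ω : ℝ → ℝ → ℝ} (hω : IsMaxSubadditive ω)
    (h : IsElectric T S x U V) (h' : IsElectric T S x' U' V') (hR : ResistanceLE S x U x' U') :
    edgeSum (fun p => ω p.1 p.2 * (p.1 - p.2)) T (fun v => (x v, x' v))
      ≤ ∑ v ∈ S, ω (x v) (x' v) * (U' v - U v) := by
  induction T with
  | source =>
    exact sum_nonneg fun v hv =>
      mul_nonneg (hω.nonneg _ _) (sub_nonneg.2 (h.voltage_mono h' hR v hv))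
  | addLayer T _ _ parent len ih =>
    obtain ⟨hpos, hx, U₀, h₀, hU⟩ := h
    obtain ⟨hpos', hx', U₀', h₀', hU'⟩ := h'
    have hR₀ := hR.push_parent hx hx' hU hU'
    have hparents := (ih h₀ h₀' hR₀).trans (sum_image_mul_le (fun v _ => hω.nonneg (x v) (x' v))
      (fun p hp => sub_nonneg.2 (h₀.voltage_mono h₀' hR₀ p hp)) fun p hp =>
        hω.exists_push_le hx hx' (fun v hv => (hpos v hv).1) (fun v hv => (hpos' v hv).1) hp)
    have hlayer : ∑ v, (len v : ℝ) * (ω (x v) (x' v) * (x v - x' v))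
        = ∑ v ∈ S, ω (x v) (x' v) * (U' v - U v)
          - ∑ v ∈ S, ω (x v) (x' v) * (U₀' (parent v) - U₀ (parent v)) := by
      rw [← sum_sub_distrib, ← sum_subset (subset_univ S)]
      · exact sum_congr rfl fun v hv => by rw [hU v hv, hU' v hv]; ring
      · intro v _ hv
        rw [hx v hv, hx' v hv, sub_self, mul_zero, mul_zero]
    rw [edgeSum, hlayer, push_prodMk]
    linarith

lemma edgeSum_posPart_le (h : IsElectric T S x U V) (h' : IsElectric T S x' U' V')
    (hR : ResistanceLE S x U x' U') :
    edgeSum (fun a => a⁺) T (fun v => x v - x' v) ≤ ∑ v ∈ S with x' v < x v, (U' v - U v) := by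
  have hpair := h.edgeSum_weight_mul_sub_le isMaxSubadditive_indicator h' hR
  simp only [ite_mul, one_mul, zero_mul, ← sum_filter] at hpair
  refine le_of_eq_of_le ?_ hpair
  rw [edgeSum_sub_apply]
  congr 1
  funext p
  split_ifs with hlt
  · exact posPart_of_nonneg (sub_nonneg.2 hlt.le)
  · exact posPart_of_nonpos (sub_nonpos.2 (not_lt.1 hlt))

lemma edgeSum_sqrt_sub_le (h : IsElectric T S x U V) (h' : IsElectric T S x' U' V')
    (hR : ResistanceLE S x U x' U') :
    edgeSum (√·) T x - edgeSum (√·) T x' ≤ ∑ v ∈ S, sqrtSlope (x v) (x' v) * (U' v - U v) := by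
  refine le_trans ?_ (h.edgeSum_weight_mul_sub_le isMaxSubadditive_sqrtSlope h' hR)
  rw [← edgeSum_fst (√·) T x x', ← edgeSum_snd (√·) T x x', ← edgeSum_sub]
  refine edgeSum_mono (fun p hp => ?_) T fun v =>
    Prod.mk_le_mk.2 ⟨h.nonneg v, h'.nonneg v⟩
  exact (sqrtSlope_mul_sub hp.1 hp.2).ge

end IsElectric

lemma exists_isElectric {m : ℕ} {T : LayeredTree m} (hT : T.PosLengths) {S : Finset (Fin m)}
    (hS : S.Nonempty) {r : Fin m → ℝ} (hr : ∀ v, 0 ≤ r v) :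
    ∃ x V, IsElectric T S x (fun v => r v * x v) V := by
  induction T with
  | source =>
    obtain ⟨v, hv⟩ := hS
    obtain rfl := Subsingleton.elim v 0
    exact ⟨fun _ => 1, r 0, hv, rfl, by simpa using hr 0, mul_one _⟩
  | addLayer T n _ parent len ih =>
    obtain ⟨hT, hlen⟩ := hT
    have hpos : ∀ v, 0 < (len v : ℝ) + r v := fun v => add_pos_of_pos_of_nonneg (hlen v) (hr v)
    set conductance := fun p => ∑ v ∈ S with parent v = p, ((len v : ℝ) + r v)⁻¹ with hdef
    have hcond : ∀ p ∈ S.image parent, 0 < conductance p := fun p hp =>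
      sum_pos (fun v _ => inv_pos.2 (hpos v)) (by simpa [filter_nonempty_iff] using hp)
    obtain ⟨x₀, V, h₀⟩ := ih hT (hS.image parent) (r := fun p => (conductance p)⁻¹)
      fun p => inv_nonneg.2 (sum_nonneg fun v _ => (inv_pos.2 (hpos v)).le)
    set U₀ := fun p => (conductance p)⁻¹ * x₀ p
    set x : Fin n → ℝ := fun v => if v ∈ S then ((len v : ℝ) + r v)⁻¹ * U₀ (parent v) else 0
    have hxS : ∀ v ∈ S, x v = ((len v : ℝ) + r v)⁻¹ * U₀ (parent v) := fun v hv => if_pos hv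
    have hx0 : ∀ v ∉ S, x v = 0 := fun v hv => if_neg hv
    have hxpos : ∀ v ∈ S, 0 < x v := fun v hv => by
      have hp := mem_image_of_mem parent hv
      rw [hxS v hv]
      exact mul_pos (inv_pos.2 (hpos v)) (mul_pos (inv_pos.2 (hcond _ hp)) (h₀.pos hp))
    have hpush : push parent x = x₀ := by
      funext p
      by_cases hp : p ∈ S.image parent
      · rw [push_apply_eq_sum_filter parent hx0, ← mul_inv_cancel_left₀ (hcond p hp).ne' (x₀ p),
          hdef, sum_mul]
        refine sum_congr rfl fun v hv => ?_
        obtain ⟨hvS, rfl⟩ := mem_filter.1 hv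
        exact hxS v hvS
      · rw [push_eq_zero parent hx0 hp, h₀.eq_zero hp]
    refine ⟨x, V, fun v hv => ⟨hxpos v hv, mul_nonneg (hr v) (hxpos v hv).le⟩, hx0, U₀,
      hpush ▸ h₀, fun v hv => ?_⟩
    rw [← add_mul, hxS v hv, add_comm (r v), mul_inv_cancel_left₀ (hpos v).ne']

/-- Two electrical flows to the same nodes, all of positive voltage, where the effective resistance
to the ground does not decrease at `p` and is unchanged at all other nodes. -/
structure IsResistanceIncreaseAt {m : ℕ} (T : LayeredTree m) (S : Finset (Fin m)) (p : Fin m)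
    (x U : Fin m → ℝ) (V : ℝ) (x' U' : Fin m → ℝ) (V' : ℝ) : Prop where
  mem : p ∈ S
  before : IsElectric T S x U V
  after : IsElectric T S x' U' V'
  voltage_pos : ∀ v ∈ S, 0 < U v
  resistance_le : U p * x' p ≤ U' p * x p
  resistance_eq : ∀ v ∈ S, v ≠ p → U' v * x v = U v * x' v

namespace IsResistanceIncreaseAt

variable {m : ℕ} {T : LayeredTree m} {S : Finset (Fin m)} {p : Fin m} {x U x' U' : Fin m → ℝ}
  {V V' : ℝ} (h : IsResistanceIncreaseAt T S p x U V x' U' V')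

include h

lemma resistanceLE : ResistanceLE S x U x' U' := by
  intro v hv
  obtain rfl | hvp := eq_or_ne v p
  · exact h.resistance_le
  · exact (h.resistance_eq v hv hvp).ge

lemma voltage_le {v : Fin m} (hv : v ∈ S) : U v ≤ U' v :=
  h.before.voltage_mono h.after h.resistanceLE v hv

lemma flow_le {v : Fin m} (hv : v ∈ S) (hvp : v ≠ p) : x v ≤ x' v := by
  refine le_of_mul_le_mul_left ?_ (h.voltage_pos v hv)
  rw [← h.resistance_eq v hv hvp]
  exact mul_le_mul_of_nonneg_right (h.voltage_le hv) (h.before.nonneg v)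

lemma flow_le_self : x' p ≤ x p := by
  have hsum := h.before.sum_eq_one.trans h.after.sum_eq_one.symm
  rw [← add_sum_erase univ _ (mem_univ p), ← add_sum_erase univ x' (mem_univ p)] at hsum
  have hrest : ∑ v ∈ univ.erase p, x v ≤ ∑ v ∈ univ.erase p, x' v := by
    refine sum_le_sum fun v hv => ?_
    by_cases hvS : v ∈ S
    · exact h.flow_le hvS (ne_of_mem_erase hv)
    · rw [h.before.eq_zero hvS, h.after.eq_zero hvS]
  linarith

lemma edgeSum_posPart_le : edgeSum (fun a => a⁺) T (fun v => x v - x' v) ≤ U' p - U p := by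
  refine (h.before.edgeSum_posPart_le h.after h.resistanceLE).trans ?_
  rw [← sum_singleton (fun v => U' v - U v) p]
  refine sum_le_sum_of_subset_of_nonneg (fun v hv => ?_) fun v hv _ => ?_
  · obtain ⟨hvS, hlt⟩ := mem_filter.1 hv
    exact mem_singleton.2 (not_imp_comm.1 (h.flow_le hvS) hlt.not_ge)
  · obtain rfl := mem_singleton.1 hv
    exact sub_nonneg.2 (h.voltage_le h.mem)

lemma source_voltage_sub : V' - V = x p * U' p - x' p * U p := by
  have hV := h.before.edgeSum_mul_add (fun v => h.after.eq_zero) h.after.sum_eq_one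
  have hV' := h.after.edgeSum_mul_add (fun v => h.before.eq_zero) h.before.sum_eq_one
  have hcomm := edgeSum_swap (fun q : ℝ × ℝ => q.1 * q.2) T x' x
  simp only [Prod.fst_swap, Prod.snd_swap, mul_comm (Prod.snd _)] at hcomm
  rw [← hV, ← hV', hcomm, add_sub_add_left_eq_sub, ← sum_sub_distrib, sum_eq_single p]
  · intro v _ hvp
    by_cases hvS : v ∈ S
    · linear_combination h.resistance_eq v hvS hvp
    · rw [h.before.eq_zero hvS, h.after.eq_zero hvS, zero_mul, zero_mul, sub_zero]
  · simp

end IsResistanceIncreaseAt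

/-! ### Erasing a target -/

/-- Two electrical flows, before and after the node `u` is removed from the set `S` of targets,
with the same effective resistances to the ground at the remaining targets. -/
structure IsErasure {m : ℕ} (T : LayeredTree m) (S : Finset (Fin m)) (u : Fin m)
    (x U : Fin m → ℝ) (V : ℝ) (x' U' : Fin m → ℝ) (V' : ℝ) : Prop where
  mem : u ∈ S
  before : IsElectric T S x U V
  after : IsElectric T (S.erase u) x' U' V'
  resistance_eq : ∀ v ∈ S.erase u, U' v * x v = U v * x' v

/-- The increase of `edgeSum (√·) T` under an erasure that cuts off a branch of length `W`, not
counting the loss in this branch itself and the contribution of the resistances below the remaining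
targets. -/
noncomputable def sqrtGain {m : ℕ} (T : LayeredTree m) (S : Finset (Fin m)) (u : Fin m)
    (x U x' U' : Fin m → ℝ) (W : ℝ) : ℝ :=
  edgeSum (√·) T x' - edgeSum (√·) T x + W * √(x u)
    + ∑ v ∈ S.erase u, sqrtSlope (x v) (x' v) * (U' v - U v)

/-- Bounds on the effect of an erasure of `u`: here `W` is the length of the branch that is lost and
`δ` is the increase of the voltage of the node at which this branch is attached. -/
structure EraseBound {m : ℕ} (T : LayeredTree m) (S : Finset (Fin m)) (u : Fin m)
    (x U : Fin m → ℝ) (V : ℝ) (x' U' : Fin m → ℝ) (V' W δ : ℝ) : Prop where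
  voltage_le : ∀ v ∈ S.erase u, U v ≤ U' v
  branch_nonneg : 0 ≤ W
  rise_nonneg : 0 ≤ δ
  upward_le : edgeSum (fun a => a⁺) T (fun v => x v - x' v) ≤ W * x u + δ
  le_source_voltage_sub : x u * (δ + W * x u + U u) ≤ V' - V
  supportLength_eq : T.supportLength x = T.supportLength x' + W
  sqrtGain_nonneg : 0 ≤ sqrtGain T S u x U x' U' W
  rise_le : δ ≤ U u + W * x u + 20 * √(x u) * sqrtGain T S u x U x' U' W

lemma voltage_le_and_flow_le {l x U x' U' : ℝ} (hl : 0 < l) (hx : 0 < x) (hU : 0 ≤ U)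
    (h : U + l * x ≤ U' + l * x') (hr : U' * x = U * x') : U ≤ U' ∧ x ≤ x' := by
  have hfactor : (U' - U) * x = U * (x' - x) := by linear_combination hr
  have hflow : x ≤ x' := by
    by_contra! hlt
    have hvoltage : U' ≤ U := by
      by_contra! hlt'
      linarith [mul_pos (sub_pos.2 hlt') hx, mul_nonneg hU (sub_nonneg.2 hlt.le)]
    linarith [mul_lt_mul_of_pos_left hlt hl]
  refine ⟨sub_nonneg.1 (nonneg_of_mul_nonneg_left ?_ hx), hflow⟩
  exact hfactor ▸ mul_nonneg hU (sub_nonneg.2 hflow)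

namespace IsErasure

variable {m n : ℕ} {T : LayeredTree m} {hn : 0 < n} {parent : Fin n → Fin m} {len : Fin n → ℝ≥0}
  {S : Finset (Fin n)} {u : Fin n} {x U x' U' : Fin n → ℝ} {U₀ U₀' : Fin m → ℝ} {V V' : ℝ}
  (h : IsErasure (addLayer T n hn parent len) S u x U V x' U' V')

include h

lemma pos {v : Fin n} (hv : v ∈ S.erase u) : 0 < x v :=
  h.before.pos (mem_of_mem_erase hv)

lemma flow_erased : x' u = 0 :=
  h.after.eq_zero (notMem_erase u S)

lemma flow_eq_zero {v : Fin n} (hv : v ∉ S) : x v = 0 ∧ x' v = 0 :=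
  ⟨h.before.eq_zero hv, h.after.eq_zero fun hv' => hv (mem_of_mem_erase hv')⟩

lemma sum_eq_add_sum_erase {F : Fin n → ℝ} (hF : ∀ v ∉ S, F v = 0) :
    ∑ v, F v = F u + ∑ v ∈ S.erase u, F v := by
  rw [add_sum_erase S F h.mem]
  exact (sum_subset (subset_univ S) fun v _ hv => hF v hv).symm

lemma edgeSum_posPart_eq (hmono : ∀ v ∈ S.erase u, x v ≤ x' v) :
    edgeSum (fun a => a⁺) (addLayer T n hn parent len) (fun v => x v - x' v)
      = edgeSum (fun a => a⁺) T (fun p => push parent x p - push parent x' p) + len u * x u := by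
  rw [edgeSum_sub_apply, edgeSum_sub_apply, edgeSum, push_prodMk, h.sum_eq_add_sum_erase,
    h.flow_erased, sub_zero, posPart_of_nonneg (h.before.nonneg u), sum_eq_zero, add_zero]
  · intro v hv
    rw [posPart_of_nonpos (sub_nonpos.2 (hmono v hv)), mul_zero]
  · intro v hv
    rw [(h.flow_eq_zero hv).1, (h.flow_eq_zero hv).2, sub_zero, posPart_zero, mul_zero]

lemma supportLength_sub_eq :
    supportLength (addLayer T n hn parent len) x - supportLength (addLayer T n hn parent len) x'
      = T.supportLength (push parent x) - T.supportLength (push parent x') + len u := by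
  have hrest : ∑ v ∈ S.erase u, (len v : ℝ) * (if x v = 0 then 0 else 1)
      = ∑ v ∈ S.erase u, (len v : ℝ) * (if x' v = 0 then 0 else 1) :=
    sum_congr rfl fun v hv => by rw [if_neg (h.pos hv).ne', if_neg (h.after.pos hv).ne']
  simp only [supportLength, edgeSum]
  rw [h.sum_eq_add_sum_erase (fun v hv => by rw [if_pos (h.flow_eq_zero hv).1, mul_zero]),
    h.sum_eq_add_sum_erase (fun v hv => by rw [if_pos (h.flow_eq_zero hv).2, mul_zero]),
    if_neg (h.before.pos h.mem).ne', if_pos h.flow_erased, hrest]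
  ring

section Parent

variable (hU : ∀ v ∈ S, U₀ (parent v) = U v + len v * x v)
  (hU' : ∀ v ∈ S.erase u, U₀' (parent v) = U' v + len v * x' v)

include hU hU'

lemma sqrtGain_add_len (W : ℝ) :
    sqrtGain (addLayer T n hn parent len) S u x U x' U' (W + len u)
      = edgeSum (√·) T (push parent x') - edgeSum (√·) T (push parent x) + W * √(x u)
        + ∑ v ∈ S.erase u, sqrtSlope (x v) (x' v) * (U₀' (parent v) - U₀ (parent v)) := by
  have hrest : ∑ v ∈ S.erase u, sqrtSlope (x v) (x' v) * (U₀' (parent v) - U₀ (parent v))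
      = ∑ v ∈ S.erase u, (len v * √(x' v) - len v * √(x v)
        + sqrtSlope (x v) (x' v) * (U' v - U v)) := by
    refine sum_congr rfl fun v hv => ?_
    rw [hU v (mem_of_mem_erase hv), hU' v hv]
    linear_combination
      (-(len v : ℝ)) * sqrtSlope_mul_sub (h.pos hv).le (h.after.pos hv).le
  rw [sqrtGain, edgeSum, edgeSum, hrest, sum_add_distrib, sum_sub_distrib,
    h.sum_eq_add_sum_erase (fun v hv => by rw [(h.flow_eq_zero hv).2, Real.sqrt_zero, mul_zero]),
    h.sum_eq_add_sum_erase (fun v hv => by rw [(h.flow_eq_zero hv).1, Real.sqrt_zero, mul_zero]),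
    h.flow_erased, Real.sqrt_zero]
  ring

lemma push_resistance_eq (p : Fin m) :
    U₀' p * ∑ v ∈ S.erase u with parent v = p, x v = U₀ p * push parent x' p := by
  rw [push_apply_eq_sum_filter parent fun v hv => h.after.eq_zero hv, mul_sum, mul_sum]
  refine sum_congr rfl fun v hv => ?_
  obtain ⟨hvS, rfl⟩ := mem_filter.1 hv
  rw [hU v (mem_of_mem_erase hvS), hU' v hvS]
  linear_combination h.resistance_eq v hvS

lemma voltage_le_and_flow_le (hlen : ∀ v, 0 < len v)
    (hparent : ∀ v ∈ S.erase u, U₀ (parent v) ≤ U₀' (parent v)) :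
    ∀ v ∈ S.erase u, U v ≤ U' v ∧ x v ≤ x' v := by
  intro v hv
  have hle := hparent v hv
  rw [hU v (mem_of_mem_erase hv), hU' v hv] at hle
  exact LayeredTree.voltage_le_and_flow_le (hlen v) (h.pos hv)
    (h.before.voltage_nonneg (mem_of_mem_erase hv)) hle (h.resistance_eq v hv)

end Parent

lemma push_apply_parent :
    push parent x (parent u) = ∑ v ∈ S.erase u with parent v = parent u, x v + x u := by
  rw [push_apply_eq_sum_filter parent fun v hv => h.before.eq_zero hv, filter_erase,
    sum_erase_add _ _ (mem_filter.2 ⟨h.mem, rfl⟩ : u ∈ {v ∈ S | parent v = parent u})]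

lemma push_apply_of_ne {p : Fin m} (hp : p ≠ parent u) :
    push parent x p = ∑ v ∈ S.erase u with parent v = p, x v := by
  rw [push_apply_eq_sum_filter parent fun v hv => h.before.eq_zero hv, filter_erase,
    erase_eq_of_notMem]
  exact fun hu => hp (mem_filter.1 hu).2.symm

lemma isResistanceIncreaseAt (hlen : ∀ v, 0 < len v) {c : Fin n} (hc : c ∈ S.erase u)
    (hcu : parent c = parent u) (h₀ : IsElectric T (S.image parent) (push parent x) U₀ V)
    (h₀' : IsElectric T (S.image parent) (push parent x') U₀' V')
    (hU : ∀ v ∈ S, U₀ (parent v) = U v + len v * x v)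
    (hU' : ∀ v ∈ S.erase u, U₀' (parent v) = U' v + len v * x' v) :
    IsResistanceIncreaseAt T (S.image parent) (parent u) (push parent x) U₀ V
      (push parent x') U₀' V' where
  mem := mem_image_of_mem parent h.mem
  before := h₀
  after := h₀'
  voltage_pos p hp := by
    obtain ⟨v, hv, rfl⟩ := mem_image.1 hp
    rw [hU v hv]
    exact add_pos_of_nonneg_of_pos (h.before.voltage_nonneg hv)
      (mul_pos (hlen v) (h.before.pos hv))
  resistance_le := by
    rw [← h.push_resistance_eq hU hU', h.push_apply_parent]
    refine mul_le_mul_of_nonneg_left (le_add_of_nonneg_right (h.before.nonneg u)) ?_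
    exact hcu ▸ h₀'.voltage_nonneg (mem_image_of_mem parent (mem_of_mem_erase hc))
  resistance_eq p _ hp := by rw [h.push_apply_of_ne hp, h.push_resistance_eq hU hU']

lemma sqrtSlope_push_le {v : Fin n} (hv : v ∈ S.erase u) :
    sqrtSlope (push parent x (parent v)) (push parent x' (parent v)) ≤ sqrtSlope (x v) (x' v) :=
  sqrtSlope_anti (h.pos hv) (le_push parent h.before.nonneg v) (le_push parent h.after.nonneg v)

end IsErasure

lemma image_erase_of_eq {α β : Type*} [DecidableEq α] [DecidableEq β] {f : α → β} {s : Finset α}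
    {a c : α} (hc : c ∈ s.erase a) (hca : f c = f a) : (s.erase a).image f = s.image f := by
  refine subset_antisymm (image_subset_image (erase_subset _ _)) fun b hb => ?_
  obtain ⟨d, hd, rfl⟩ := mem_image.1 hb
  obtain rfl | hda := eq_or_ne d a
  · exact hca ▸ mem_image_of_mem f hc
  · exact mem_image_of_mem f (mem_erase.2 ⟨hda, hd⟩)

lemma image_erase_of_forall_ne {α β : Type*} [DecidableEq α] [DecidableEq β] {f : α → β}
    {s : Finset α} {a : α} (h : ∀ c ∈ s.erase a, f c ≠ f a) :
    (s.erase a).image f = (s.image f).erase (f a) := by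
  ext b
  simp only [mem_image, mem_erase]
  constructor
  · rintro ⟨c, ⟨hca, hc⟩, rfl⟩
    exact ⟨h c (mem_erase.2 ⟨hca, hc⟩), c, hc, rfl⟩
  · rintro ⟨hb, c, hc, rfl⟩
    exact ⟨c, ⟨fun hca => hb (hca ▸ rfl), hc⟩, rfl⟩

lemma one_le_mul_sqrtSlope_sub {a b z t X : ℝ} (ha : 0 < a) (haz : a ≤ z) (hzX : z < X)
    (hbt : b ≤ t) (htX : t ≤ z + X) :
    1 ≤ 20 * √X * (sqrtSlope a b - sqrtSlope (z + X) t) := by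
  have hz : 0 < z := ha.trans_le haz
  have hX : 0 < X := hz.trans hzX
  have hτ : √t ≤ √(z + X) := Real.sqrt_le_sqrt htX
  have hsq : √(z + X) ^ 2 = √z ^ 2 + √X ^ 2 := by
    rw [Real.sq_sqrt hz.le, Real.sq_sqrt hX.le, Real.sq_sqrt (add_pos hz hX).le]
  have hqξ : √z ^ 2 ≤ √X ^ 2 := by rw [Real.sq_sqrt hz.le, Real.sq_sqrt hX.le]; exact hzX.le
  have hqs : 4 * √z ≤ 3 * √(z + X) :=
    (sq_le_sq₀ (by positivity) (by positivity)).1 (by linarith [sq_nonneg √X])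
  have hsξ : 7 * √(z + X) ≤ 10 * √X :=
    (sq_le_sq₀ (by positivity) (by positivity)).1 (by linarith [sq_nonneg √X])
  have hslope : sqrtSlope z t ≤ sqrtSlope a b := sqrtSlope_anti ha haz hbt
  refine le_trans ?_ (mul_le_mul_of_nonneg_left (sub_le_sub_right hslope _) (by positivity))
  have hdiff : sqrtSlope z t - sqrtSlope (z + X) t
      = (√(z + X) - √z) / ((√z + √t) * (√(z + X) + √t)) := by
    unfold sqrtSlope
    field_simp
    ring
  rw [hdiff, mul_div_assoc', one_le_div (by positivity)]
  calc (√z + √t) * (√(z + X) + √t) ≤ (7 / 4 * √(z + X)) * (2 * √(z + X)) := by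
        gcongr <;> linarith
    _ = 20 * (7 / 10 * √(z + X)) * (√(z + X) / 4) := by ring
    _ ≤ 20 * √X * (√(z + X) - √z) := by gcongr <;> linarith

section AddLayer

variable {m n : ℕ} {T : LayeredTree m} {hn : 0 < n} {parent : Fin n → Fin m} {len : Fin n → ℝ≥0}
  {S : Finset (Fin n)} {u : Fin n} {x U x' U' : Fin n → ℝ} {U₀ U₀' : Fin m → ℝ} {V V' W δ : ℝ}

lemma IsErasure.mul_sub_le_sqrtGain (h : IsErasure (addLayer T n hn parent len) S u x U V x' U' V')
    (hU : ∀ v ∈ S, U₀ (parent v) = U v + len v * x v)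
    (hU' : ∀ v ∈ S.erase u, U₀' (parent v) = U' v + len v * x' v) {c : Fin n}
    (hc : c ∈ S.erase u) (hcu : parent c = parent u)
    (h₀ : IsResistanceIncreaseAt T (S.image parent) (parent u) (push parent x) U₀ V
      (push parent x') U₀' V') :
    (sqrtSlope (x c) (x' c) - sqrtSlope (push parent x (parent u)) (push parent x' (parent u)))
        * (U₀' (parent u) - U₀ (parent u))
      ≤ sqrtGain (addLayer T n hn parent len) S u x U x' U' (len u) := by
  have himage := image_erase_of_eq hc hcu
  set Ω : Fin m → ℝ := fun p => sqrtSlope (push parent x p) (push parent x' p)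
  have hlayer : ∑ p ∈ S.image parent,
      Function.update Ω (parent u) (sqrtSlope (x c) (x' c)) p * (U₀' p - U₀ p)
      ≤ ∑ v ∈ S.erase u, sqrtSlope (x v) (x' v) * (U₀' (parent v) - U₀ (parent v)) := by
    rw [← himage]
    refine sum_image_mul_le (fun v _ => sqrtSlope_nonneg _ _)
      (fun p hp => sub_nonneg.2 (h₀.voltage_le (himage ▸ hp))) fun p hp => ?_
    obtain rfl | hpu := eq_or_ne p (parent u)
    · exact ⟨c, hc, hcu, by rw [Function.update_self]⟩
    · obtain ⟨v, hv, rfl⟩ := mem_image.1 hp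
      exact ⟨v, hv, rfl, by rw [Function.update_of_ne hpu]; exact h.sqrtSlope_push_le hv⟩
  have hupper := h₀.before.edgeSum_sqrt_sub_le h₀.after h₀.resistanceLE
  have hgain := h.sqrtGain_add_len hU hU' 0
  rw [zero_add, zero_mul, add_zero] at hgain
  rw [← add_sum_erase _ _ h₀.mem] at hlayer hupper
  rw [Function.update_self, sum_congr rfl fun p hp => by
    rw [Function.update_of_ne (ne_of_mem_erase hp)]] at hlayer
  rw [hgain]
  linarith

lemma IsErasure.rise_le_of_sibling (h : IsErasure (addLayer T n hn parent len) S u x U V x' U' V')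
    (hU : ∀ v ∈ S, U₀ (parent v) = U v + len v * x v)
    (hU' : ∀ v ∈ S.erase u, U₀' (parent v) = U' v + len v * x' v) {c : Fin n}
    (hc : c ∈ S.erase u) (hcu : parent c = parent u)
    (h₀ : IsResistanceIncreaseAt T (S.image parent) (parent u) (push parent x) U₀ V
      (push parent x') U₀' V')
    (hgain : 0 ≤ sqrtGain (addLayer T n hn parent len) S u x U x' U' (len u)) :
    U₀' (parent u) - U₀ (parent u) ≤ U u + len u * x u
      + 20 * √(x u) * sqrtGain (addLayer T n hn parent len) S u x U x' U' (len u) := by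
  have hδ := sub_nonneg.2 (h₀.voltage_le h₀.mem)
  have hroot : 0 ≤ 20 * √(x u) := by positivity
  have hxp := h.push_apply_parent
  have hresistance := h.push_resistance_eq hU hU' (parent u)
  have hflow := h₀.flow_le_self
  have hUu := hU u h.mem
  have hvoltage := h₀.voltage_pos _ h₀.mem
  set z := ∑ v ∈ S.erase u with parent v = parent u, x v
  have hcz : x c ≤ z :=
    single_le_sum (f := x) (fun v _ => h.before.nonneg v) (mem_filter.2 ⟨hc, hcu⟩)
  have hz := (h.pos hc).trans_le hcz
  rcases le_or_gt (x u) z with hle | hlt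
  · have hdouble : U₀' (parent u) * z ≤ 2 * U₀ (parent u) * z := by
      rw [hresistance, mul_comm 2, mul_assoc]
      exact mul_le_mul_of_nonneg_left (by linarith) hvoltage.le
    linarith [le_of_mul_le_mul_right hdouble hz, mul_nonneg hroot hgain]
  · have hslope := one_le_mul_sqrtSlope_sub (h.pos hc) hcz hlt
      (hcu ▸ le_push parent h.after.nonneg c) (hxp ▸ hflow)
    have hle := mul_le_mul_of_nonneg_left (h.mul_sub_le_sqrtGain hU hU' hc hcu h₀) hroot
    rw [hxp, ← mul_assoc] at hle
    linarith [mul_le_mul_of_nonneg_right hslope hδ, hvoltage]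

lemma IsErasure.eraseBound_of_sibling
    (h : IsErasure (addLayer T n hn parent len) S u x U V x' U' V')
    (hU : ∀ v ∈ S, U₀ (parent v) = U v + len v * x v)
    (hU' : ∀ v ∈ S.erase u, U₀' (parent v) = U' v + len v * x' v) (hlen : ∀ v, 0 < len v)
    {c : Fin n} (hc : c ∈ S.erase u) (hcu : parent c = parent u)
    (h₀ : IsResistanceIncreaseAt T (S.image parent) (parent u) (push parent x) U₀ V
      (push parent x') U₀' V') :
    EraseBound (addLayer T n hn parent len) S u x U V x' U' V' (len u)
      (U₀' (parent u) - U₀ (parent u)) := by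
  have hδ := sub_nonneg.2 (h₀.voltage_le h₀.mem)
  have hmono := h.voltage_le_and_flow_le hU hU' hlen fun v hv =>
    h₀.voltage_le (mem_image_of_mem parent (mem_of_mem_erase hv))
  have hgain : 0 ≤ sqrtGain (addLayer T n hn parent len) S u x U x' U' (len u) :=
    (mul_nonneg (sub_nonneg.2 (hcu ▸ h.sqrtSlope_push_le hc)) hδ).trans
      (h.mul_sub_le_sqrtGain hU hU' hc hcu h₀)
  refine ⟨fun v hv => (hmono v hv).1, (len u).2, hδ, ?_, ?_, ?_, hgain,
    h.rise_le_of_sibling hU hU' hc hcu h₀ hgain⟩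
  · rw [h.edgeSum_posPart_eq fun v hv => (hmono v hv).2]
    linarith [h₀.edgeSum_posPart_le]
  · have hresistance := h.push_resistance_eq hU hU' (parent u)
    rw [h₀.source_voltage_sub, h.push_apply_parent]
    linear_combination (-x u) * hU u h.mem - hresistance
  · linarith [h.supportLength_sub_eq, h₀.before.supportLength_eq h₀.after]

lemma IsErasure.isErasure_push (h : IsErasure (addLayer T n hn parent len) S u x U V x' U' V')
    (hU : ∀ v ∈ S, U₀ (parent v) = U v + len v * x v)
    (hU' : ∀ v ∈ S.erase u, U₀' (parent v) = U' v + len v * x' v)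
    (h₀ : IsElectric T (S.image parent) (push parent x) U₀ V)
    (h₀' : IsElectric T ((S.image parent).erase (parent u)) (push parent x') U₀' V') :
    IsErasure T (S.image parent) (parent u) (push parent x) U₀ V (push parent x') U₀' V' :=
  ⟨mem_image_of_mem parent h.mem, h₀, h₀', fun p hp => by
    rw [h.push_apply_of_ne (ne_of_mem_erase hp), h.push_resistance_eq hU hU']⟩

lemma EraseBound.addLayer
    (hB : EraseBound T (S.image parent) (parent u) (push parent x) U₀ V (push parent x') U₀' V' W δ)
    (h : IsErasure (addLayer T n hn parent len) S u x U V x' U' V')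
    (hU : ∀ v ∈ S, U₀ (parent v) = U v + len v * x v)
    (hU' : ∀ v ∈ S.erase u, U₀' (parent v) = U' v + len v * x' v) (hlen : ∀ v, 0 < len v)
    (hsibling : ∀ v ∈ S.erase u, parent v ≠ parent u) :
    EraseBound (addLayer T n hn parent len) S u x U V x' U' V' (W + len u) δ := by
  obtain ⟨hvoltage, hW, hδ, hup, hsource, hsupp, hgain, hrise⟩ := hB
  have himage := image_erase_of_forall_ne hsibling
  have hmono := h.voltage_le_and_flow_le hU hU' hlen fun v hv =>
    hvoltage _ (himage ▸ mem_image_of_mem parent hv)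
  have hxp : push parent x (parent u) = x u := by
    rw [h.push_apply_parent, filter_false_of_mem hsibling, sum_empty, zero_add]
  have hle : sqrtGain T (S.image parent) (parent u) (push parent x) U₀ (push parent x') U₀' W
      ≤ sqrtGain (LayeredTree.addLayer T n hn parent len) S u x U x' U' (W + len u) := by
    rw [h.sqrtGain_add_len hU hU', sqrtGain, hxp, ← himage]
    refine add_le_add_right (sum_image_mul_le (fun v _ => sqrtSlope_nonneg _ _) (fun p hp =>
      sub_nonneg.2 (hvoltage p (himage ▸ hp))) fun p hp => ?_) _
    obtain ⟨v, hv, rfl⟩ := mem_image.1 hp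
    exact ⟨v, hv, rfl, h.sqrtSlope_push_le hv⟩
  rw [hxp] at hup hsource hrise
  rw [hU u h.mem] at hsource hrise
  refine ⟨fun v hv => (hmono v hv).1, add_nonneg hW (len u).2, hδ, ?_, ?_, ?_, hgain.trans hle, ?_⟩
  · rw [h.edgeSum_posPart_eq fun v hv => (hmono v hv).2]
    linarith
  · linarith
  · linarith [h.supportLength_sub_eq]
  · linarith [mul_le_mul_of_nonneg_left hle (show 0 ≤ 20 * √(x u) by positivity)]

end AddLayer

theorem IsErasure.exists_eraseBound {m : ℕ} {T : LayeredTree m} (hT : T.PosLengths)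
    {S : Finset (Fin m)} {u : Fin m} {x U x' U' : Fin m → ℝ} {V V' : ℝ}
    (h : IsErasure T S u x U V x' U' V') : ∃ W δ, EraseBound T S u x U V x' U' V' W δ := by
  induction T with
  | source => exact absurd (Subsingleton.elim u 0 ▸ h.after.1) (notMem_erase u S)
  | addLayer T _ _ parent len ih =>
    obtain ⟨_, _, U₀, h₀, hU⟩ := id h.before
    obtain ⟨_, _, U₀', h₀', hU'⟩ := id h.after
    by_cases hsibling : ∃ c ∈ S.erase u, parent c = parent u
    · obtain ⟨c, hc, hcu⟩ := hsibling
      rw [image_erase_of_eq hc hcu] at h₀'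
      exact ⟨_, _, h.eraseBound_of_sibling hU hU' hT.2 hc hcu
        (h.isResistanceIncreaseAt hT.2 hc hcu h₀ h₀' hU hU')⟩
    · push Not at hsibling
      rw [image_erase_of_forall_ne hsibling] at h₀'
      obtain ⟨W, δ, hB⟩ := ih hT.1 (h.isErasure_push hU hU' h₀ h₀')
      exact ⟨_, _, hB.addLayer h hU hU' hT.2 hsibling⟩

lemma edgeSum_posPart_triangle {m : ℕ} (T : LayeredTree m) (x y z : Fin m → ℝ) :
    edgeSum (fun a => a⁺) T (fun v => x v - z v)
      ≤ edgeSum (fun a => a⁺) T (fun v => x v - y v)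
        + edgeSum (fun a => a⁺) T (fun v => y v - z v) := by
  have hsub : ∀ a b : ℝ, (a + b)⁺ ≤ a⁺ + b⁺ := fun a b =>
    sup_le (add_le_add (le_posPart a) (le_posPart b))
      (add_nonneg (posPart_nonneg a) (posPart_nonneg b))
  simpa using edgeSum_add_apply_le hsub T (fun v => x v - y v) fun v => y v - z v

/-- The potential of the electrical flow `x` with voltage `V` of the source, whose increase pays for
all upward movement of mass. -/
noncomputable def potential (κ : ℝ) {m : ℕ} (T : LayeredTree m) (x : Fin m → ℝ) (V : ℝ) : ℝ :=
  edgeSum (√·) T x / √κ + (2 * T.length - T.supportLength x) / κ + κ * V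

lemma mul_sq_add_le_of_le {w σ g δ : ℝ} (hw : 0 ≤ w) (hg : 0 ≤ g) (hδ : 0 ≤ δ)
    (h : δ ≤ w * σ ^ 2 + 20 * σ * g) :
    w * σ ^ 2 + δ ≤ 20 * (g - w * σ + w + σ ^ 2 * (δ + w * σ ^ 2)) := by
  have hpoly : σ ^ 2 ≤ 2 * (1 - σ + σ ^ 4) := by
    linarith [sq_nonneg (2 * σ ^ 2 - 1), sq_nonneg (σ - 1)]
  have hwpoly := mul_le_mul_of_nonneg_left hpoly hw
  have hwσ : 0 ≤ w * σ ^ 2 := by positivity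
  rcases le_total σ 1 with hσ1 | hσ1
  · linarith [mul_le_mul_of_nonneg_right hσ1 hg, mul_nonneg (sq_nonneg σ) hδ]
  · linarith [mul_le_mul_of_nonneg_right (one_le_pow₀ hσ1 : 1 ≤ σ ^ 2) hδ]

lemma IsElectric.edgeSum_posPart_le_of_erase {κ : ℝ} (hκ : 0 < κ) {m : ℕ} {T : LayeredTree m}
    (hT : T.PosLengths) {S : Finset (Fin m)} {u : Fin m} (hu : u ∈ S) {x x' : Fin m → ℝ}
    {V V' : ℝ} (h : IsElectric T S x 0 V) (h' : IsElectric T (S.erase u) x' 0 V') :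
    edgeSum (fun a => a⁺) T (fun v => x v - x' v)
      ≤ 20 * (potential κ T x' V' - potential κ T x V) := by
  obtain ⟨W, δ, hB⟩ := IsErasure.exists_eraseBound hT ⟨hu, h, h', fun v _ => by simp⟩
  obtain ⟨-, hW, hδ, hup, hsource, hsupp, hgain, hrise⟩ := hB
  have hgain_eq : sqrtGain T S u x 0 x' 0 W
      = edgeSum (√·) T x' - edgeSum (√·) T x + W * √(x u) := by simp [sqrtGain]
  set G := sqrtGain T S u x 0 x' 0 W
  rw [Pi.zero_apply, zero_add] at hrise
  rw [Pi.zero_apply, add_zero] at hsource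
  have hX : √(x u) ^ 2 = x u := Real.sq_sqrt (h.nonneg u)
  have hκ' : √κ ^ 2 = κ := Real.sq_sqrt hκ.le
  have hκpos : 0 < √κ := Real.sqrt_pos.2 hκ
  have hWX : W / κ * (√κ * √(x u)) ^ 2 = W * x u := by
    rw [mul_pow, hκ', hX]; field_simp
  have hcore := mul_sq_add_le_of_le (w := W / κ) (σ := √κ * √(x u)) (g := G / √κ) (δ := δ)
    (by positivity) (by positivity) hδ
    (by rw [hWX]; convert hrise using 2; field_simp)
  rw [hWX, mul_pow, hκ', hX] at hcore
  have hloss : W / κ * (√κ * √(x u)) = W * √(x u) / √κ := by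
    rw [← hκ', Real.sqrt_sq hκpos.le]; field_simp
  have hpotential : potential κ T x' V' - potential κ T x V
      = G / √κ - W * √(x u) / √κ + W / κ + κ * (V' - V) := by
    rw [potential, potential, hsupp, hgain_eq]; ring
  rw [hpotential]
  linarith [mul_le_mul_of_nonneg_left hsource hκ.le]

lemma exists_isElectric_zero {m : ℕ} {T : LayeredTree m} (hT : T.PosLengths) {S : Finset (Fin m)}
    (hS : S.Nonempty) : ∃ x V, IsElectric T S x 0 V := by
  obtain ⟨x, V, h⟩ := exists_isElectric hT hS (r := 0) fun _ => le_rfl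
  exact ⟨x, V, by simpa [Pi.zero_def] using h⟩

lemma IsElectric.exists_subset {κ : ℝ} (hκ : 0 < κ) {m : ℕ} {T : LayeredTree m}
    (hT : T.PosLengths) {S S' : Finset (Fin m)} (hS' : S'.Nonempty) (hSS' : S' ⊆ S)
    {x : Fin m → ℝ} {V : ℝ} (h : IsElectric T S x 0 V) :
    ∃ x' V', IsElectric T S' x' 0 V' ∧ edgeSum (fun a => a⁺) T (fun v => x v - x' v)
      ≤ 20 * (potential κ T x' V' - potential κ T x V) := by
  induction S using Finset.strongInduction generalizing x V with
  | H S ih =>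
    rcases hSS'.eq_or_ssubset with rfl | hss
    · refine ⟨x, V, h, ?_⟩
      simp only [sub_self, mul_zero]
      exact (edgeSum_zero posPart_zero T).le
    · obtain ⟨u, hu, huS'⟩ := exists_of_ssubset hss
      have hsub : S' ⊆ S.erase u := subset_erase.2 ⟨hSS', huS'⟩
      obtain ⟨y, B, hy⟩ := exists_isElectric_zero hT (hS'.mono hsub)
      obtain ⟨x', V', h', hle⟩ := ih (S.erase u) (erase_ssubset hu) hsub hy
      refine ⟨x', V', h', (edgeSum_posPart_triangle T x y x').trans ?_⟩
      linarith [h.edgeSum_posPart_le_of_erase hκ hT hu hy]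

section Energy

variable {m : ℕ} {T : LayeredTree m} {S : Finset (Fin m)} {x y U : Fin m → ℝ} {V : ℝ}

lemma IsElectric.edgeSum_mul_self_add (h : IsElectric T S x U V) :
    edgeSum (fun a => a * a) T x + ∑ v, x v * U v = V := by
  rw [← h.edgeSum_mul_add (fun v => h.eq_zero) h.sum_eq_one,
    edgeSum_diag (fun p : ℝ × ℝ => p.1 * p.2)]

lemma IsElectric.edgeSum_mul_self (h : IsElectric T S x 0 V) :
    edgeSum (fun a => a * a) T x = V := by
  simpa using h.edgeSum_mul_self_add

/-- Thomson's principle. -/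
lemma IsElectric.le_edgeSum_mul_self (h : IsElectric T S x 0 V) (hy : ∀ v ∉ S, y v = 0)
    (hy₁ : ∑ v, y v = 1) : V ≤ edgeSum (fun a => a * a) T y := by
  have hpair : edgeSum (fun p : ℝ × ℝ => p.1 * p.2) T (fun v => (x v, y v)) = V := by
    simpa using h.edgeSum_mul_add hy hy₁
  have hexpand : edgeSum (fun a => a * a) T (fun v => x v - y v)
      = edgeSum (fun a => a * a) T x + edgeSum (fun a => a * a) T y - 2 * V := by
    rw [edgeSum_sub_apply, ← edgeSum_fst (fun a : ℝ => a * a) T x y,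
      ← edgeSum_snd (fun a : ℝ => a * a) T x y, ← hpair, ← edgeSum_const_mul, ← edgeSum_add,
      ← edgeSum_sub]
    congr 1
    funext p
    ring
  have hnonneg := edgeSum_nonneg (f := fun a : ℝ => a * a) mul_self_nonneg T fun v => x v - y v
  rw [hexpand, h.edgeSum_mul_self] at hnonneg
  linarith

end Energy

section AddLayer

variable {m n : ℕ} {T : LayeredTree m} {hn : 0 < n} {parent : Fin n → Fin m} {len : Fin n → ℝ≥0}
  {x U₀ : Fin m → ℝ} {x' : Fin n → ℝ} {V V' : ℝ}

lemma resistanceLE_zero {S : Finset (Fin m)} {y : Fin m → ℝ} (hx : ∀ v, 0 ≤ x v)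
    (hU₀ : ∀ v ∈ S, 0 ≤ U₀ v) : ResistanceLE S x 0 y U₀ := fun v hv => by
  rw [Pi.zero_apply, zero_mul]
  exact mul_nonneg (hU₀ v hv) (hx v)

variable (h : IsElectric T (univ.image parent) x 0 V)
  (h₀ : IsElectric T (univ.image parent) (push parent x') U₀ V')
  (hU₀ : ∀ v, U₀ (parent v) = len v * x' v)

include h h₀ hU₀

lemma edgeSum_posPart_le_of_addLayer :
    edgeSum (fun a => a⁺) T (fun p => x p - push parent x' p) ≤ ∑ v, (len v : ℝ) * x' v := by
  have hR := resistanceLE_zero (y := push parent x') h.nonneg fun p => h₀.voltage_nonneg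
  calc edgeSum (fun a => a⁺) T (fun p => x p - push parent x' p)
      ≤ ∑ p ∈ univ.image parent with push parent x' p < x p, U₀ p := by
        simpa using h.edgeSum_posPart_le h₀ hR
    _ ≤ ∑ p ∈ univ.image parent, 1 * U₀ p := by
        simp only [one_mul]
        exact sum_le_sum_of_subset_of_nonneg (filter_subset _ _) fun p hp _ => h₀.voltage_nonneg hp
    _ ≤ ∑ v, 1 * U₀ (parent v) :=
        sum_image_mul_le (fun _ _ => zero_le_one) (fun p => h₀.voltage_nonneg) fun p hp => by
          obtain ⟨v, hv, rfl⟩ := mem_image.1 hp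
          exact ⟨v, hv, rfl, le_rfl⟩
    _ = ∑ v, (len v : ℝ) * x' v := by simp only [one_mul, hU₀]

lemma edgeSum_sqrt_sub_le_of_addLayer (hx' : ∀ v, 0 ≤ x' v) :
    edgeSum (√·) T x - edgeSum (√·) T (push parent x') ≤ ∑ v, (len v : ℝ) * √(x' v) := by
  have hR := resistanceLE_zero (y := push parent x') h.nonneg fun p => h₀.voltage_nonneg
  have hedges := h.edgeSum_sqrt_sub_le h₀ hR
  simp only [Pi.zero_apply, sub_zero] at hedges
  refine hedges.trans ((sum_image_mul_le (ω := fun v =>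
    sqrtSlope (x (parent v)) (push parent x' (parent v))) (fun v _ => sqrtSlope_nonneg _ _)
    (fun p => h₀.voltage_nonneg) fun p hp => ?_).trans (sum_le_sum fun v _ => ?_))
  · obtain ⟨v, hv, rfl⟩ := mem_image.1 hp
    exact ⟨v, hv, rfl, le_rfl⟩
  · have hroot : √(x' v) ≤ √(x (parent v)) + √(push parent x' (parent v)) :=
      (Real.sqrt_le_sqrt (le_push parent hx' v)).trans (le_add_of_nonneg_left (Real.sqrt_nonneg _))
    have hslope : sqrtSlope (x (parent v)) (push parent x' (parent v)) * √(x' v) ≤ 1 := by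
      rw [sqrtSlope, one_div_mul_eq_div]
      exact div_le_one_of_le₀ hroot (by positivity)
    calc sqrtSlope (x (parent v)) (push parent x' (parent v)) * U₀ (parent v)
        = len v * √(x' v) * (sqrtSlope (x (parent v)) (push parent x' (parent v)) * √(x' v)) := by
          rw [hU₀]
          linear_combination (-(sqrtSlope (x (parent v)) (push parent x' (parent v)) * len v))
            * Real.mul_self_sqrt (hx' v)
      _ ≤ len v * √(x' v) := mul_le_of_le_one_right (by positivity) hslope

lemma sum_mul_sq_le_of_addLayer : ∑ v, (len v : ℝ) * x' v ^ 2 ≤ V' - V := by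
  have hthomson := h.le_edgeSum_mul_self (fun v => h₀.eq_zero) h₀.sum_eq_one
  have hlayer : ∑ p, push parent x' p * U₀ p = ∑ v, (len v : ℝ) * x' v ^ 2 := by
    rw [sum_push_mul]
    exact sum_congr rfl fun v _ => by rw [hU₀]; ring
  linarith [h₀.edgeSum_mul_self_add]

end AddLayer

lemma two_mul_sum_mul_le {κ : ℝ} (hκ : 0 < κ) {ι : Type*} [Fintype ι] (len : ι → ℝ≥0)
    (x : ι → ℝ) : 2 * ∑ v, (len v : ℝ) * x v
      ≤ (∑ v, (len v : ℝ)) / κ + κ * ∑ v, (len v : ℝ) * x v ^ 2 := by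
  have hsq : 0 ≤ ∑ v, (len v : ℝ) * (κ * (x v - 1 / κ) ^ 2) :=
    sum_nonneg fun v _ => by positivity
  have hexpand : ∀ v, (len v : ℝ) * (κ * (x v - 1 / κ) ^ 2)
      = len v / κ + κ * (len v * x v ^ 2) - 2 * (len v * x v) := fun v => by
    field_simp
    ring
  simp only [hexpand, sum_sub_distrib, sum_add_distrib, ← mul_sum, ← sum_div] at hsq
  linarith

lemma IsElectric.edgeSum_posPart_add_le {κ : ℝ} (hκ : 0 < κ) {m n : ℕ} {T : LayeredTree m}
    {hn : 0 < n} {parent : Fin n → Fin m} {len : Fin n → ℝ≥0} {x : Fin m → ℝ} {x' : Fin n → ℝ}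
    {V V' : ℝ} (h : IsElectric T (univ.image parent) x 0 V)
    (h' : IsElectric (addLayer T n hn parent len) univ x' 0 V') :
    edgeSum (fun a => a⁺) T (fun p => x p - push parent x' p) + ∑ v, (len v : ℝ) * x' v
      ≤ potential κ (addLayer T n hn parent len) x' V' - potential κ T x V := by
  have hpos : ∀ v, 0 < x' v := fun v => h'.pos (mem_univ v)
  obtain ⟨_, _, U₀, h₀, hU⟩ := h'
  have hU₀ : ∀ v, U₀ (parent v) = len v * x' v := fun v => by simpa using hU v (mem_univ v)
  have hup := edgeSum_posPart_le_of_addLayer h h₀ hU₀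
  have hsqrt := div_nonneg (sub_nonneg.2 (edgeSum_sqrt_sub_le_of_addLayer h h₀ hU₀ fun v =>
    (hpos v).le)) (Real.sqrt_nonneg κ)
  have hvoltage := mul_le_mul_of_nonneg_left (sum_mul_sq_le_of_addLayer h h₀ hU₀) hκ.le
  have hsupp : supportLength (addLayer T n hn parent len) x'
      = T.supportLength x + ∑ v, (len v : ℝ) := by
    rw [h.supportLength_eq h₀, supportLength, supportLength, edgeSum]
    exact congrArg _ (sum_congr rfl fun v _ => by rw [if_neg (hpos v).ne', mul_one])
  have hpotential : potential κ (addLayer T n hn parent len) x' V' - potential κ T x V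
      = (∑ v, (len v : ℝ) * √(x' v)
          - (edgeSum (√·) T x - edgeSum (√·) T (push parent x'))) / √κ
        + (∑ v, (len v : ℝ)) / κ + κ * (V' - V) := by
    rw [potential, potential, hsupp, edgeSum, length]
    ring
  rw [hpotential]
  linarith [two_mul_sum_mul_le hκ len x']

theorem IsElectric.edgeSum_posPart_le_of_addLayer {κ : ℝ} (hκ : 0 < κ) {m n : ℕ}
    {T : LayeredTree m} (hT : T.PosLengths) {hn : 0 < n} {parent : Fin n → Fin m}
    {len : Fin n → ℝ≥0} {x : Fin m → ℝ} {x' : Fin n → ℝ} {V V' : ℝ} (h : IsElectric T univ x 0 V)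
    (h' : IsElectric (addLayer T n hn parent len) univ x' 0 V') :
    edgeSum (fun a => a⁺) T (fun p => x p - push parent x' p)
      ≤ 20 * (potential κ (addLayer T n hn parent len) x' V' - potential κ T x V) := by
  have : Nonempty (Fin n) := ⟨⟨0, hn⟩⟩
  obtain ⟨y, B, hy, hle⟩ := h.exists_subset hκ hT (univ_nonempty.image parent) (subset_univ _)
  have hlayer := hy.edgeSum_posPart_add_le hκ h'
  have hforward : 0 ≤ ∑ v, (len v : ℝ) * x' v :=
    sum_nonneg fun v _ => mul_nonneg (len v).2 (h'.nonneg v)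
  have hupward := edgeSum_nonneg (f := fun a : ℝ => a⁺) posPart_nonneg T
    fun p => y p - push parent x' p
  linarith [edgeSum_posPart_triangle T x y (push parent x')]

lemma IsElectric.edgeSum_id_le {κ : ℝ} (hκ : 0 < κ) {m : ℕ} {T : LayeredTree m} {x : Fin m → ℝ}
    {V : ℝ} (h : IsElectric T univ x 0 V) :
    edgeSum (fun a => a) T x ≤ T.length / κ + κ * V := by
  rw [← h.edgeSum_mul_self, ← edgeSum_one T x, div_eq_inv_mul, ← edgeSum_const_mul,
    ← edgeSum_const_mul, ← edgeSum_add]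
  refine edgeSum_mono (fun a ha => ?_) T h.nonneg
  have hsq : κ⁻¹ * 1 + κ * (a * a) - a = κ * (a - κ⁻¹) ^ 2 + a := by
    field_simp
    ring
  linarith [mul_nonneg hκ.le (sq_nonneg (a - κ⁻¹))]

lemma edgeSum_sqrt_div_le {κ : ℝ} (hκ : 0 < κ) {m : ℕ} (T : LayeredTree m) {x : Fin m → ℝ}
    (hx : ∀ v, 0 ≤ x v) :
    edgeSum (√·) T x / √κ ≤ T.length / κ + edgeSum (fun a => a) T x := by
  rw [← edgeSum_one T x, div_eq_inv_mul, div_eq_inv_mul, ← edgeSum_const_mul,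
    ← edgeSum_const_mul, ← edgeSum_add]
  refine edgeSum_mono (fun a ha => ?_) T hx
  have hroot : (√κ)⁻¹ ^ 2 = κ⁻¹ := by rw [inv_pow, Real.sq_sqrt hκ.le]
  have hmean := two_mul_le_add_sq (√κ)⁻¹ √a
  rw [hroot, Real.sq_sqrt ha] at hmean
  have : 0 ≤ (√κ)⁻¹ * √a := by positivity
  linarith

lemma IsElectric.potential_le {κ : ℝ} (hκ : 0 < κ) {m : ℕ} {T : LayeredTree m} {x : Fin m → ℝ}
    {V : ℝ} (h : IsElectric T univ x 0 V) :
    potential κ T x V ≤ 4 * (T.length / κ) + 2 * (κ * V) := by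
  have hsupp : 0 ≤ T.supportLength x :=
    edgeSum_nonneg (fun a => by split_ifs <;> norm_num) T x
  have hlength : (2 * T.length - T.supportLength x) / κ ≤ 2 * (T.length / κ) := by
    rw [← mul_div_assoc]
    gcongr
    linarith
  rw [potential]
  linarith [edgeSum_sqrt_div_le hκ T h.nonneg, h.edgeSum_id_le hκ]

lemma IsElectric.voltage_le_depth {m : ℕ} {T : LayeredTree m} {x : Fin m → ℝ} {V : ℝ}
    (h : IsElectric T univ x 0 V) (t : Fin m) : V ≤ T.depth t := by
  simpa [edgeSum_single] using h.le_edgeSum_mul_self (y := Pi.single t 1) (by simp) (by simp)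

lemma depth_nonneg {m : ℕ} (T : LayeredTree m) (t : Fin m) : 0 ≤ T.depth t := by
  induction T with
  | source => exact le_rfl
  | addLayer T _ _ parent len ih => exact add_nonneg (ih _) (len t).2

lemma depth_le_length {m : ℕ} (T : LayeredTree m) (t : Fin m) : T.depth t ≤ T.length := by
  induction T with
  | source => exact le_rfl
  | addLayer T _ _ parent len ih =>
    exact add_le_add (ih _) (single_le_sum (f := fun v => (len v : ℝ)) (fun v _ => (len v).2)
      (mem_univ t))

lemma nonempty_fin {m : ℕ} (T : LayeredTree m) : Nonempty (Fin m) := by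
  cases T with
  | source => exact ⟨0⟩
  | addLayer T n hn parent len => exact ⟨⟨0, hn⟩⟩

/-! ### Fractional algorithms -/

section FractionalAlgorithm

/-- The transport distance of two mass distributions on the last layer: every edge `e` carries the
difference of the masses that `x` and `y` put below `e`. -/
noncomputable def transportDist {m : ℕ} (T : LayeredTree m) (x y : Fin m → ℝ) : ℝ :=
  edgeSum (fun a => |a|) T fun v => x v - y v

lemma transportDist_eq {m : ℕ} (T : LayeredTree m) (x y : Fin m → ℝ) :
    T.transportDist x y = 2 * edgeSum (fun a => a⁺) T (fun v => x v - y v)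
      - edgeSum (fun a => a) T x + edgeSum (fun a => a) T y := by
  have habs : (fun a : ℝ => |a|) = fun a => 2 * a⁺ - a := by
    funext a
    linarith [posPart_add_negPart a, posPart_sub_negPart a]
  have hid : edgeSum (fun a => a) T (fun v => x v - y v)
      = edgeSum (fun a => a) T x - edgeSum (fun a => a) T y := by
    rw [edgeSum_sub_apply, edgeSum_sub, edgeSum_fst fun a => a, edgeSum_snd fun a => a]
  rw [transportDist, habs, edgeSum_sub, edgeSum_const_mul, hid]
  ring

lemma transportDist_le_add {m : ℕ} (T : LayeredTree m) {x y : Fin m → ℝ} (hx : ∀ v, 0 ≤ x v)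
    (hy : ∀ v, 0 ≤ y v) :
    T.transportDist x y ≤ edgeSum (fun a => a) T x + edgeSum (fun a => a) T y := by
  rw [transportDist, edgeSum_sub_apply, ← edgeSum_fst (fun a => a) T x y,
    ← edgeSum_snd (fun a => a) T x y, ← edgeSum_add]
  refine edgeSum_mono (fun p hp => ?_) T fun v => Prod.le_def.2 ⟨hx v, hy v⟩
  obtain ⟨hp₁, hp₂⟩ := Prod.le_def.1 hp
  exact (abs_sub _ _).trans (add_le_add (abs_of_nonneg hp₁).le (abs_of_nonneg hp₂).le)

lemma continuous_edgeSum {M : Type*} [AddCommMonoid M] [TopologicalSpace M] [ContinuousAdd M]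
    {f : M → ℝ} (hf : Continuous f) {m : ℕ} (T : LayeredTree m) :
    Continuous fun x : Fin m → M => edgeSum f T x := by
  induction T with
  | source => exact continuous_const
  | addLayer T _ _ parent len ih =>
    exact (ih.comp (FunOnFinite.continuous_map M parent)).add
      (continuous_finsetSum _ fun v _ => (hf.comp (continuous_apply v)).const_mul _)

lemma tendsto_transportDist {ι : Type*} {l : Filter ι} {m : ℕ} (T : LayeredTree m)
    {x x' : ι → Fin m → ℝ} {y y' : Fin m → ℝ} (h : Tendsto x l (𝓝 y)) (h' : Tendsto x' l (𝓝 y')) :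
    Tendsto (fun i => T.transportDist (x i) (x' i)) l (𝓝 (T.transportDist y y')) :=
  ((continuous_edgeSum continuous_abs T).tendsto _).comp (h.sub h')

/-- A fractional algorithm maintains a probability distribution on the last layer. -/
structure FractionalAlgorithm where
  /-- The distribution on the last layer of a tree. -/
  mass : {m : ℕ} → LayeredTree m → Fin m → ℝ
  mass_mem : ∀ {m : ℕ} (T : LayeredTree m), mass T ∈ stdSimplex ℝ (Fin m)

namespace FractionalAlgorithm

/-- The distance travelled by the mass: in each step, it is transported to the parents of its new
positions and moves on to the next layer. -/
noncomputable def travelled (X : FractionalAlgorithm) : {m : ℕ} → LayeredTree m → ℝ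
  | _, source => 0
  | _, addLayer T n hn parent len =>
      X.travelled T
        + (T.transportDist (X.mass T) (push parent (X.mass (addLayer T n hn parent len)))
          + ∑ v, (len v : ℝ) * X.mass (addLayer T n hn parent len) v)

/-- The cost of a fractional algorithm: at the end, all mass is transported to the target. -/
noncomputable def cost (X : FractionalAlgorithm) {m : ℕ} (T : LayeredTree m) (t : Fin m) : ℝ :=
  X.travelled T + T.transportDist (X.mass T) (Pi.single t 1)

end FractionalAlgorithm

end FractionalAlgorithm

section Stretch

/-- The tree with all edge lengths increased by `ε`. -/
def stretch (ε : ℝ≥0) : {m : ℕ} → LayeredTree m → LayeredTree m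
  | _, source => source
  | _, addLayer T n hn parent len => addLayer (T.stretch ε) n hn parent fun v => len v + ε

lemma stretch_zero {m : ℕ} (T : LayeredTree m) : T.stretch 0 = T := by
  induction T with
  | source => rfl
  | addLayer T _ _ parent len ih => simp [stretch, ih]

lemma posLengths_stretch {ε : ℝ≥0} (hε : 0 < ε) {m : ℕ} (T : LayeredTree m) :
    (T.stretch ε).PosLengths := by
  induction T with
  | source => trivial
  | addLayer T _ _ _ len ih => exact ⟨ih, fun v => add_pos_of_nonneg_of_pos zero_le hε⟩

lemma continuous_length_stretch {m : ℕ} (T : LayeredTree m) :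
    Continuous fun ε : ℝ≥0 => (T.stretch ε).length := by
  induction T with
  | source => exact continuous_const
  | addLayer T _ _ parent len ih =>
    simp only [stretch, length]
    fun_prop

lemma continuous_depth_stretch {m : ℕ} (T : LayeredTree m) (t : Fin m) :
    Continuous fun ε : ℝ≥0 => (T.stretch ε).depth t := by
  induction T with
  | source => exact continuous_const
  | addLayer T _ _ parent len ih =>
    have := ih (parent t)
    simp only [stretch, depth]
    fun_prop

lemma edgeSum_le_stretch {M : Type*} [AddCommMonoid M] {f : M → ℝ} (hf : ∀ a, 0 ≤ f a) (ε : ℝ≥0)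
    {m : ℕ} (T : LayeredTree m) (x : Fin m → M) : edgeSum f T x ≤ edgeSum f (T.stretch ε) x := by
  induction T with
  | source => exact le_rfl
  | addLayer T _ _ parent len ih =>
    refine add_le_add (ih _) (sum_le_sum fun v _ => mul_le_mul_of_nonneg_right ?_ (hf _))
    exact_mod_cast le_self_add

lemma transportDist_le_stretch (ε : ℝ≥0) {m : ℕ} (T : LayeredTree m) (x y : Fin m → ℝ) :
    T.transportDist x y ≤ (T.stretch ε).transportDist x y :=
  edgeSum_le_stretch abs_nonneg ε T _

end Stretch

lemma le_mul_sqrt_of_forall_pos {c L D : ℝ} (hD : 0 < D) (hDL : D ≤ L)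
    (h : ∀ κ > 0, c ≤ 162 * (L / κ) + 82 * (κ * D) + D) : c ≤ 245 * √(L * D) := by
  have hL : 0 < √L := Real.sqrt_pos.2 (hD.trans_le hDL)
  have hDpos : 0 < √D := Real.sqrt_pos.2 hD
  have hroots : √D ≤ √L := Real.sqrt_le_sqrt hDL
  have hoptimal := h (√L / √D) (div_pos hL hDpos)
  have hlength : L / (√L / √D) = √L * √D := by
    field_simp
    rw [Real.sq_sqrt (hD.le.trans hDL)]
  have hdepth : √L / √D * D = √L * √D := by
    field_simp
    rw [Real.sq_sqrt hD.le]
  rw [hlength, hdepth] at hoptimal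
  rw [Real.sqrt_mul (hD.le.trans hDL)]
  linarith [mul_le_mul_of_nonneg_right hroots hDpos.le, Real.mul_self_sqrt hD.le]

namespace FractionalAlgorithm

/-- A fractional algorithm whose mass distribution is the electrical flow to the last layer of the
tree with all edge lengths increased by `ε`. -/
def IsElectricOfStretch (X : FractionalAlgorithm) (ε : ℝ≥0) : Prop :=
  ∀ (m : ℕ) (T : LayeredTree m), ∃ V, IsElectric (T.stretch ε) univ (X.mass T) 0 V

lemma exists_isElectricOfStretch {ε : ℝ≥0} (hε : 0 < ε) :
    ∃ X : FractionalAlgorithm, X.IsElectricOfStretch ε := by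
  choose x V h using fun (m : ℕ) (T : LayeredTree m) =>
    exists_isElectric_zero (posLengths_stretch hε T) (@univ_nonempty _ _ T.nonempty_fin)
  exact ⟨⟨x _, fun T => ⟨(h _ T).nonneg, (h _ T).sum_eq_one⟩⟩, fun m T => ⟨V m T, h m T⟩⟩

variable {X : FractionalAlgorithm} {ε : ℝ≥0}

lemma IsElectricOfStretch.travelled_le (hX : X.IsElectricOfStretch ε) (hε : 0 < ε) {κ : ℝ}
    (hκ : 0 < κ) {m : ℕ} {T : LayeredTree m} {V : ℝ}
    (h : IsElectric (T.stretch ε) univ (X.mass T) 0 V) :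
    X.travelled T ≤ 40 * potential κ (T.stretch ε) (X.mass T) V
      + edgeSum (fun a => a) (T.stretch ε) (X.mass T) := by
  induction T generalizing V with
  | source =>
    obtain ⟨-, -, -, hV⟩ := h
    simp [travelled, stretch, potential, supportLength, edgeSum, length, ← hV]
  | addLayer T n hn parent len ih =>
    obtain ⟨V₀, h₀⟩ := hX _ T
    have hup := h₀.edgeSum_posPart_le_of_addLayer hκ (posLengths_stretch hε T) h
    have htransport := transportDist_le_stretch ε T (X.mass T)
      (push parent (X.mass (addLayer T n hn parent len)))
    rw [transportDist_eq (T.stretch ε)] at htransport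
    have hforward : ∑ v, (len v : ℝ) * X.mass (addLayer T n hn parent len) v
        ≤ ∑ v, ((len v + ε : ℝ≥0) : ℝ) * X.mass (addLayer T n hn parent len) v := by
      refine sum_le_sum fun v _ => mul_le_mul_of_nonneg_right ?_ ((X.mass_mem _).1 v)
      exact_mod_cast le_self_add
    rw [travelled]
    simp only [stretch, edgeSum] at hup ⊢
    linarith [ih h₀]

lemma IsElectricOfStretch.cost_le (hX : X.IsElectricOfStretch ε) (hε : 0 < ε) {κ : ℝ}
    (hκ : 0 < κ) {m : ℕ} (T : LayeredTree m) (t : Fin m) :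
    X.cost T t ≤ 162 * ((T.stretch ε).length / κ) + 82 * (κ * (T.stretch ε).depth t)
      + (T.stretch ε).depth t := by
  obtain ⟨V, h⟩ := hX _ T
  have htarget := (transportDist_le_stretch ε T _ _).trans ((T.stretch ε).transportDist_le_add
    h.nonneg (Pi.single_nonneg.2 zero_le_one : (0 : Fin m → ℝ) ≤ Pi.single t 1))
  rw [edgeSum_single rfl, mul_one] at htarget
  have hV := mul_le_mul_of_nonneg_left (h.voltage_le_depth t) hκ.le
  rw [cost]
  linarith [hX.travelled_le hε hκ h, h.potential_le hκ, h.edgeSum_id_le hκ]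

lemma IsElectricOfStretch.cost_le_sqrt (hX : X.IsElectricOfStretch ε) (hε : 0 < ε) {m : ℕ}
    (T : LayeredTree m) (t : Fin m) :
    X.cost T t ≤ 245 * √((T.stretch ε).length * (T.stretch ε).depth t) := by
  have hcost := fun {κ : ℝ} (hκ : 0 < κ) => hX.cost_le hε hκ T t
  have hle := (T.stretch ε).depth_le_length t
  cases T with
  | source => simp [cost, travelled, transportDist, edgeSum, stretch, length]
  | addLayer T _ hn parent len =>
    have hlen : 0 < ((len t + ε : ℝ≥0) : ℝ) := by positivity
    have hdepth : 0 < (stretch ε (addLayer T m hn parent len)).depth t :=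
      add_pos_of_nonneg_of_pos ((T.stretch ε).depth_nonneg (parent t)) hlen
    exact le_mul_sqrt_of_forall_pos hdepth hle fun κ hκ => hcost hκ

section Limit

variable {ι : Type*}

lemma exists_tendsto_mass (𝒰 : Ultrafilter ι) (X : ι → FractionalAlgorithm) :
    ∃ Y : FractionalAlgorithm, ∀ {m : ℕ} (T : LayeredTree m),
      Tendsto (fun i => (X i).mass T) 𝒰 (𝓝 (Y.mass T)) := by
  have hlim : ∀ (m : ℕ) (T : LayeredTree m), ∃ y ∈ stdSimplex ℝ (Fin m),
      Tendsto (fun i => (X i).mass T) 𝒰 (𝓝 y) := fun m T =>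
    (isCompact_stdSimplex ℝ (Fin m)).ultrafilter_le_nhds (𝒰.map fun i => (X i).mass T)
      (tendsto_principal.2 (Eventually.of_forall fun i => (X i).mass_mem T))
  choose y hy hlim using hlim
  exact ⟨⟨y _, hy _⟩, hlim _⟩

variable {l : Filter ι} {X : ι → FractionalAlgorithm} {Y : FractionalAlgorithm}
  (h : ∀ {m : ℕ} (T : LayeredTree m), Tendsto (fun i => (X i).mass T) l (𝓝 (Y.mass T)))

include h

lemma tendsto_travelled {m : ℕ} (T : LayeredTree m) :
    Tendsto (fun i => (X i).travelled T) l (𝓝 (Y.travelled T)) := by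
  induction T with
  | source => exact tendsto_const_nhds
  | addLayer T n hn parent len ih =>
    have hX := h (addLayer T n hn parent len)
    refine ih.add ((tendsto_transportDist T (h T)
      (((FunOnFinite.continuous_map ℝ parent).tendsto _).comp hX)).add ?_)
    exact tendsto_finsetSum _ fun v _ => (tendsto_pi_nhds.1 hX v).const_mul _

lemma tendsto_cost {m : ℕ} (T : LayeredTree m) (t : Fin m) :
    Tendsto (fun i => (X i).cost T t) l (𝓝 (Y.cost T t)) :=
  (tendsto_travelled h T).add (tendsto_transportDist T (h T) tendsto_const_nhds)

end Limit

theorem exists_cost_le_sqrt : ∃ X : FractionalAlgorithm, ∀ {m : ℕ} (T : LayeredTree m) (t : Fin m),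
    X.cost T t ≤ 245 * √(T.length * T.depth t) := by
  let ε : ℕ → ℝ≥0 := fun n => 1 / ((n : ℝ≥0) + 1)
  have hε : Tendsto ε (hyperfilter ℕ : Filter ℕ) (𝓝 0) :=
    (tendsto_one_div_add_atTop_nhds_zero_nat (𝕜 := ℝ≥0)).mono_left
      (Nat.cofinite_eq_atTop ▸ hyperfilter_le_cofinite)
  choose X hX using fun n => exists_isElectricOfStretch (ε := ε n) (by positivity)
  obtain ⟨Y, hY⟩ := exists_tendsto_mass (hyperfilter ℕ) X
  refine ⟨Y, fun T t => le_of_tendsto_of_tendsto' (tendsto_cost hY T t) ?_ fun n =>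
    (hX n).cost_le_sqrt (by positivity) T t⟩
  have hbound : Continuous fun δ : ℝ≥0 =>
      245 * √((T.stretch δ).length * (T.stretch δ).depth t) :=
    ((T.continuous_length_stretch.mul (T.continuous_depth_stretch t)).sqrt).const_mul 245
  simpa only [stretch_zero, Function.comp_def] using (hbound.tendsto 0).comp hε

end FractionalAlgorithm

/-! ### Transport plans -/

section Coupling

variable {α β γ δ : Type*} [Fintype α] [Fintype β] [Fintype γ] [Fintype δ]

/-- `π` is a transport plan that moves the mass distribution `a` to `b`. -/
structure IsCoupling (π : α → β → ℝ) (a : α → ℝ) (b : β → ℝ) : Prop where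
  nonneg : ∀ u v, 0 ≤ π u v
  sum_right : ∀ u, ∑ v, π u v = a u
  sum_left : ∀ v, ∑ u, π u v = b v

namespace IsCoupling

lemma swap {π : α → β → ℝ} {a : α → ℝ} {b : β → ℝ} (h : IsCoupling π a b) :
    IsCoupling (fun v u => π u v) b a :=
  ⟨fun v u => h.nonneg u v, h.sum_left, h.sum_right⟩

lemma single [DecidableEq α] {a : α → ℝ} (ha : ∀ u, 0 ≤ a u) :
    IsCoupling (fun u => Pi.single u (a u)) a a where
  nonneg u v := (Pi.single_nonneg.2 (ha u) : (0 : α → ℝ) ≤ Pi.single u (a u)) v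
  sum_right u := by simp
  sum_left v := by simp [Pi.single_apply]

lemma add {π π' : α → β → ℝ} {a a' : α → ℝ} {b b' : β → ℝ} (h : IsCoupling π a b)
    (h' : IsCoupling π' a' b') :
    IsCoupling (fun u v => π u v + π' u v) (fun u => a u + a' u) (fun v => b v + b' v) where
  nonneg u v := add_nonneg (h.nonneg u v) (h'.nonneg u v)
  sum_right u := by rw [sum_add_distrib, h.sum_right, h'.sum_right]
  sum_left v := by rw [sum_add_distrib, h.sum_left, h'.sum_left]

lemma sum_mul_left {π : α → β → ℝ} {a : α → ℝ} {b : β → ℝ} (h : IsCoupling π a b) (c : α → ℝ) :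
    ∑ u, ∑ v, π u v * c u = ∑ u, c u * a u :=
  sum_congr rfl fun u _ => by rw [← sum_mul, h.sum_right, mul_comm]

lemma sum_mul_right {π : α → β → ℝ} {a : α → ℝ} {b : β → ℝ} (h : IsCoupling π a b) (c : β → ℝ) :
    ∑ u, ∑ v, π u v * c v = ∑ v, c v * b v := by
  rw [sum_comm]
  exact h.swap.sum_mul_left c

lemma exists_lift_right {π : α → γ → ℝ} {a : α → ℝ} {b : β → ℝ} (g : β → γ) (hb : ∀ v, 0 ≤ b v)
    (h : IsCoupling π a (push g b)) :
    ∃ σ, IsCoupling σ a b ∧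
      ∀ c : α → γ → ℝ, ∑ u, ∑ v, σ u v * c u (g v) = ∑ u, ∑ q, π u q * c u q := by
  classical
  set σ : α → β → ℝ := fun u v => b v / push g b (g v) * π u (g v)
  have hpush : ∀ u q, push g (σ u) q = π u q := fun u q => by
    have hfiber : push g (σ u) q = push g b q / push g b q * π u q := calc
      push g (σ u) q = ∑ v with g v = q, b v / push g b q * π u q := by
        rw [push_apply]
        exact sum_congr rfl fun v hv => by rw [← (mem_filter.1 hv).2]
      _ = push g b q / push g b q * π u q := by rw [← sum_mul, ← sum_div, ← push_apply g b q]
    by_cases hq : push g b q = 0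
    · have hπ : π u q ≤ push g b q :=
        h.sum_left q ▸ single_le_sum (f := fun u => π u q) (fun u _ => h.nonneg u q) (mem_univ u)
      rw [hfiber, (hπ.trans hq.le).antisymm (h.nonneg u q), mul_zero]
    · rw [hfiber, div_self hq, one_mul]
  refine ⟨σ, ⟨fun u v => ?_, fun u => ?_, fun v => ?_⟩, fun c => sum_congr rfl fun u _ => ?_⟩
  · exact mul_nonneg (div_nonneg (hb v) (push_nonneg g hb _)) (h.nonneg u _)
  · rw [← sum_push g, ← h.sum_right]
    exact sum_congr rfl fun q _ => hpush u q
  · rw [← mul_sum, h.sum_left]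
    refine div_mul_cancel_of_imp fun hv => ?_
    exact ((le_push g hb v).trans hv.le).antisymm (hb v)
  · rw [← sum_push_mul g (σ u)]
    exact sum_congr rfl fun q _ => by rw [hpush]

lemma exists_lift {π : γ → δ → ℝ} {a : α → ℝ} {b : β → ℝ} (f : α → γ) (g : β → δ)
    (ha : ∀ u, 0 ≤ a u) (hb : ∀ v, 0 ≤ b v) (h : IsCoupling π (push f a) (push g b)) :
    ∃ σ, IsCoupling σ a b ∧
      ∀ c : γ → δ → ℝ, ∑ u, ∑ v, σ u v * c (f u) (g v) = ∑ p, ∑ q, π p q * c p q := by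
  obtain ⟨τ, hτ, hτπ⟩ := h.exists_lift_right g hb
  obtain ⟨σ, hσ, hστ⟩ := hτ.swap.exists_lift_right f ha
  refine ⟨fun u v => σ v u, hσ.swap, fun c => ?_⟩
  rw [← hτπ, sum_comm, hστ fun v p => c p (g v), sum_comm]

lemma exists_of_posPart_negPart {a b : α → ℝ} (ha : ∀ v, 0 ≤ a v) (hb : ∀ v, 0 ≤ b v)
    {τ : α → α → ℝ} (h : IsCoupling τ (fun v => (a v - b v)⁺) fun v => (a v - b v)⁻) :
    ∃ π, IsCoupling π a b ∧ ∀ d : α → α → ℝ, (∀ v, d v v = 0) →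
      ∑ u, ∑ v, π u v * d u v = ∑ u, ∑ v, τ u v * d u v := by
  classical
  have hmin : ∀ v, min (a v) (b v) + (a v - b v)⁺ = a v
      ∧ min (a v) (b v) + (a v - b v)⁻ = b v := fun v => by
    rcases le_total (a v) (b v) with hle | hle <;> simp [hle]
  have hsum := (IsCoupling.single fun v => le_min (ha v) (hb v)).add h
  simp only [(hmin _).1, (hmin _).2] at hsum
  refine ⟨_, hsum, fun d hd => ?_⟩
  simp [add_mul, sum_add_distrib, Pi.single_apply, hd]

end IsCoupling

end Coupling

lemma push_sub {α β G : Type*} [AddCommGroup G] [Finite α] [Finite β] (parent : α → β)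
    (x y : α → G) :
    push parent (fun v => x v - y v) = fun p => push parent x p - push parent y p :=
  map_sub (FunOnFinite.linearMap ℤ G parent) x y

lemma dist_self {m : ℕ} (T : LayeredTree m) (u : Fin m) : T.dist u u = 0 := by
  cases T with
  | source => rfl
  | addLayer => exact if_pos rfl

lemma dist_nonneg {m : ℕ} (T : LayeredTree m) (u v : Fin m) : 0 ≤ T.dist u v := by
  induction T with
  | source => exact le_rfl
  | addLayer T _ _ parent len ih =>
    rw [dist]
    have := ih (parent u) (parent v)
    split_ifs <;> positivity

lemma dist_addLayer_le {m n : ℕ} (T : LayeredTree m) (hn : 0 < n) (parent : Fin n → Fin m)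
    (len : Fin n → ℝ≥0) (u v : Fin n) :
    (addLayer T n hn parent len).dist u v ≤ len u + T.dist (parent u) (parent v) + len v := by
  have := T.dist_nonneg (parent u) (parent v)
  rw [dist]
  split_ifs
  · positivity
  · exact le_rfl

theorem exists_isCoupling_sum_dist_le {m : ℕ} (T : LayeredTree m) {a b : Fin m → ℝ}
    (ha : ∀ v, 0 ≤ a v) (hb : ∀ v, 0 ≤ b v) (hab : ∑ v, a v = ∑ v, b v) :
    ∃ π, IsCoupling π a b ∧ ∑ u, ∑ v, π u v * T.dist u v ≤ T.transportDist a b := by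
  induction T with
  | source =>
    refine ⟨fun _ _ => a 0, ⟨fun _ _ => ha 0, fun u => ?_, fun v => ?_⟩, ?_⟩
    · simp [Subsingleton.elim u 0]
    · rw [Subsingleton.elim v 0]
      simpa using hab
    · simp [dist, transportDist, edgeSum]
  | addLayer T n hn parent len ih =>
    have hparts : ∀ v, (a v - b v)⁺ - (a v - b v)⁻ = a v - b v := fun v => posPart_sub_negPart _
    obtain ⟨π, hπ, hcost⟩ := ih (a := push parent fun v => (a v - b v)⁺)
      (b := push parent fun v => (a v - b v)⁻) (push_nonneg parent fun v => posPart_nonneg _)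
      (push_nonneg parent fun v => negPart_nonneg _) (by
        rw [sum_push, sum_push, ← sub_eq_zero, ← sum_sub_distrib]
        simp only [hparts, sum_sub_distrib, hab, sub_self])
    rw [transportDist, ← push_sub] at hcost
    simp only [hparts] at hcost
    obtain ⟨τ, hτ, hτπ⟩ := hπ.exists_lift parent parent (fun v => posPart_nonneg (a v - b v))
      fun v => negPart_nonneg (a v - b v)
    obtain ⟨σ, hσ, hστ⟩ := hτ.exists_of_posPart_negPart ha hb
    refine ⟨σ, hσ, ?_⟩
    rw [hστ _ (dist_self _)]
    calc ∑ u, ∑ v, τ u v * (addLayer T n hn parent len).dist u v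
        ≤ ∑ u, ∑ v, (τ u v * len u + τ u v * T.dist (parent u) (parent v) + τ u v * len v) :=
          sum_le_sum fun u _ => sum_le_sum fun v _ => by
            rw [← mul_add, ← mul_add]
            exact mul_le_mul_of_nonneg_left (dist_addLayer_le T hn parent len u v) (hτ.nonneg u v)
      _ = ∑ p, ∑ q, π p q * T.dist p q + ∑ v, (len v : ℝ) * |a v - b v| := by
          simp only [sum_add_distrib, hτπ, hτ.sum_mul_left fun u => (len u : ℝ),
            hτ.sum_mul_right fun v => (len v : ℝ), ← posPart_add_negPart, mul_add]
          ring
      _ ≤ (addLayer T n hn parent len).transportDist a b := by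
          rw [transportDist, edgeSum]
          gcongr

theorem exists_isCoupling_sum_dist_add_le {m n : ℕ} (T : LayeredTree m) (parent : Fin n → Fin m)
    (len : Fin n → ℝ≥0) {a : Fin m → ℝ} {b : Fin n → ℝ} (ha : ∀ v, 0 ≤ a v)
    (hb : ∀ v, 0 ≤ b v) (hab : ∑ v, a v = ∑ v, b v) :
    ∃ σ, IsCoupling σ a b ∧ ∑ u, ∑ v, σ u v * (T.dist u (parent v) + len v)
      ≤ T.transportDist a (push parent b) + ∑ v, (len v : ℝ) * b v := by
  obtain ⟨π, hπ, hcost⟩ := T.exists_isCoupling_sum_dist_le ha (push_nonneg parent hb)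
    (hab.trans (sum_push parent b).symm)
  obtain ⟨σ, hσ, hσπ⟩ := hπ.exists_lift_right parent hb
  refine ⟨σ, hσ, ?_⟩
  simp only [mul_add, sum_add_distrib]
  rw [hσπ fun u q => T.dist u q, hσ.sum_mul_right fun v => (len v : ℝ)]
  gcongr

/-! ### Independent decisions -/

/-- The number of layers below the source. -/
def layers : {m : ℕ} → LayeredTree m → ℕ
  | _, source => 0
  | _, addLayer T _ _ _ _ => T.layers + 1

/-- The σ-algebra generated by the decisions on trees with fewer than `h` layers. -/
abbrev past (h : ℕ) : MeasurableSpace DetAlgorithm :=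
  ⨆ s ∈ {s : Situation | s.tree.layers < h},
    MeasurableSpace.comap (fun a : DetAlgorithm => a s) inferInstance

lemma measurable_decision (s : Situation) : Measurable fun a : DetAlgorithm => a s :=
  measurable_pi_apply (X := fun s : Situation => Fin s.n) s

lemma past_le (h : ℕ) : past h ≤ (inferInstance : MeasurableSpace DetAlgorithm) :=
  iSup₂_le fun s _ => (measurable_decision s).comap_le

lemma past_mono {h h' : ℕ} (hh : h ≤ h') : past h ≤ past h' :=
  biSup_mono fun _ hs => lt_of_lt_of_le hs hh

lemma measurableSet_past_decision {h : ℕ} {s : Situation} (hs : s.tree.layers < h) (v : Fin s.n) :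
    MeasurableSet[past h] {a : DetAlgorithm | a s = v} :=
  le_biSup (fun s : Situation => MeasurableSpace.comap (fun a : DetAlgorithm => a s)
    inferInstance) (show s ∈ {s : Situation | s.tree.layers < h} from hs) _
    ⟨{v}, measurableSet_singleton v, rfl⟩

lemma measurableSet_past_position {m : ℕ} (T : LayeredTree m) (u : Fin m) :
    MeasurableSet[past T.layers] {a : DetAlgorithm | position a T = u} := by
  induction T with
  | source => simp [Subsingleton.elim _ u]
  | @addLayer m T n hn parent len ih =>
    have hsplit : {a : DetAlgorithm | position a (addLayer T n hn parent len) = u}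
        = ⋃ w, {a | position a T = w} ∩ {a | a ⟨m, T, w, n, hn, parent, len⟩ = u} := by
      ext a
      simp [position]
    rw [hsplit]
    exact MeasurableSet.iUnion fun w => (past_mono (Nat.le_succ _) _ (ih w)).inter
      (measurableSet_past_decision (s := ⟨m, T, w, n, hn, parent, len⟩) (Nat.lt_succ_self _) u)

lemma measurable_position {m : ℕ} (T : LayeredTree m) :
    Measurable fun a : DetAlgorithm => position a T :=
  measurable_to_countable' fun u => past_le _ _ (measurableSet_past_position T u)

section Integrability

variable {μ : Measure DetAlgorithm} [IsFiniteMeasure μ] {m : ℕ} (T : LayeredTree m)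

lemma integrable_step {n : ℕ} (hn : 0 < n) (parent : Fin n → Fin m) (len : Fin n → ℝ≥0)
    (F : Fin m → Fin n → ℝ) :
    Integrable (fun a => F (position a T) (position a (addLayer T n hn parent len))) μ :=
  (Integrable.of_finite (f := fun p : Fin m × Fin n => F p.1 p.2)).comp_measurable
    ((measurable_position T).prodMk (measurable_position (addLayer T n hn parent len)))

lemma integrable_travelled : Integrable (fun a => travelled a T) μ := by
  induction T with
  | source => exact integrable_zero _ _ _
  | addLayer T n hn parent len ih =>
    exact ih.add (T.integrable_step hn parent len fun u v => T.dist u (parent v) + len v)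

lemma integrable_dist_position (t : Fin m) : Integrable (fun a => T.dist (position a T) t) μ :=
  (Integrable.of_finite (f := fun u => T.dist u t)).comp_measurable (measurable_position T)

lemma integrable_cost (t : Fin m) : Integrable (fun a => cost a T t) μ :=
  T.integrable_travelled.add (T.integrable_dist_position t)

end Integrability

lemma integral_comp_eq_sum {Ω β : Type*} [MeasurableSpace Ω] {μ : Measure Ω} [IsFiniteMeasure μ]
    [Fintype β] [MeasurableSpace β] [MeasurableSingletonClass β] {f : Ω → β} (hf : Measurable f)
    (F : β → ℝ) : ∫ a, F (f a) ∂μ = ∑ b, μ.real (f ⁻¹' {b}) * F b := by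
  have hF : Integrable F (μ.map f) := Integrable.of_finite
  rw [← integral_map hf.aemeasurable hF.aestronglyMeasurable, integral_fintype hF]
  exact sum_congr rfl fun b _ => by
    rw [map_measureReal_apply hf (measurableSet_singleton b), smul_eq_mul]

/-- The law of an algorithm whose decisions in the situations `s` are independent with laws
`P s`. -/
noncomputable def independentDecisions (P : (s : Situation) → Measure (Fin s.n)) :
    Measure DetAlgorithm :=
  Measure.infinitePi P

section IndependentDecisions

variable (P : (s : Situation) → Measure (Fin s.n)) [∀ s, IsProbabilityMeasure (P s)]

instance : IsProbabilityMeasure (independentDecisions P) :=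
  inferInstanceAs (IsProbabilityMeasure (Measure.infinitePi P))

lemma measureReal_decision (s : Situation) (v : Fin s.n) :
    (independentDecisions P).real {a | a s = v} = (P s).real {v} :=
  (measurePreserving_eval_infinitePi P s).measureReal_preimage
    (measurableSet_singleton v).nullMeasurableSet

lemma indep_past_decision {h : ℕ} {s : Situation} (hs : h ≤ s.tree.layers) :
    Indep (past h) (MeasurableSpace.comap (fun a : DetAlgorithm => a s) inferInstance)
      (independentDecisions P) := by
  have hind : iIndepFun (fun (s : Situation) (a : DetAlgorithm) => a s) (independentDecisions P) :=
    iIndepFun_infinitePi (X := fun _ w => w) fun _ => measurable_id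
  simpa only [_root_.iSup_singleton] using
    indep_iSup_of_disjoint (fun s => (measurable_decision s).comap_le) hind
      (S := {s : Situation | s.tree.layers < h}) (T := {s})
      (Set.disjoint_singleton_right.2 hs.not_gt)

lemma measureReal_step {m n : ℕ} (T : LayeredTree m) (hn : 0 < n) (parent : Fin n → Fin m)
    (len : Fin n → ℝ≥0) (u : Fin m) (v : Fin n) :
    (independentDecisions P).real
        ({a | position a T = u} ∩ {a | position a (addLayer T n hn parent len) = v})
      = (independentDecisions P).real {a | position a T = u}
        * (P ⟨m, T, u, n, hn, parent, len⟩).real {v} := by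
  have hdecision :
      {a | position a T = u} ∩ {a | position a (addLayer T n hn parent len) = v}
        = {a | position a T = u} ∩ {a | a ⟨m, T, u, n, hn, parent, len⟩ = v} := by
    ext a
    refine and_congr_right ?_
    rintro rfl
    rfl
  have hindep := (Indep_iff _ _ _).1
    (indep_past_decision P (s := ⟨m, T, u, n, hn, parent, len⟩) le_rfl) _
    {a | a ⟨m, T, u, n, hn, parent, len⟩ = v}
    (measurableSet_past_position T u) ⟨{v}, measurableSet_singleton v, rfl⟩
  rw [hdecision, ← measureReal_decision, Measure.real, hindep, ENNReal.toReal_mul]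
  rfl

lemma integral_step {m n : ℕ} (T : LayeredTree m) (hn : 0 < n) (parent : Fin n → Fin m)
    (len : Fin n → ℝ≥0) (F : Fin m → Fin n → ℝ) :
    ∫ a, F (position a T) (position a (addLayer T n hn parent len)) ∂independentDecisions P
      = ∑ u, ∑ v, (independentDecisions P).real {a | position a T = u}
        * (P ⟨m, T, u, n, hn, parent, len⟩).real {v} * F u v := by
  rw [integral_comp_eq_sum ((measurable_position T).prodMk (measurable_position _))
    fun p : Fin m × Fin n => F p.1 p.2, Fintype.sum_prod_type]
  refine sum_congr rfl fun u _ => sum_congr rfl fun v _ => ?_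
  rw [← measureReal_step, ← Set.singleton_prod_singleton, Set.mk_preimage_prod]
  rfl

end IndependentDecisions

lemma exists_isProbabilityMeasure_sum_mul {n : ℕ} (hn : 0 < n) {c : Fin n → ℝ}
    (hc : ∀ v, 0 ≤ c v) :
    ∃ ν : Measure (Fin n), IsProbabilityMeasure ν ∧ ∀ v, (∑ w, c w) * ν.real {v} = c v := by
  by_cases hs : ∑ w, c w = 0
  · refine ⟨Measure.dirac ⟨0, hn⟩, inferInstance, fun v => ?_⟩
    rw [hs, zero_mul, (sum_eq_zero_iff_of_nonneg fun w _ => hc w).1 hs v (mem_univ v)]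
  · have hnonneg : ∀ v, 0 ≤ c v / ∑ w, c w := fun v =>
      div_nonneg (hc v) (sum_nonneg fun w _ => hc w)
    have hone : ∑ v, ENNReal.ofReal (c v / ∑ w, c w) = 1 := by
      rw [← ENNReal.ofReal_sum_of_nonneg fun v _ => hnonneg v, ← sum_div, div_self hs,
        ENNReal.ofReal_one]
    refine ⟨(PMF.ofFintype _ hone).toMeasure, inferInstance, fun v => ?_⟩
    rw [Measure.real, PMF.toMeasure_apply_singleton _ _ (measurableSet_singleton v),
      PMF.ofFintype_apply, ENNReal.toReal_ofReal (hnonneg v), mul_div_cancel₀ _ hs]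

lemma sum_mul_dist_le_transportDist_single {m : ℕ} (T : LayeredTree m) {x : Fin m → ℝ}
    (hx : x ∈ stdSimplex ℝ (Fin m)) (t : Fin m) :
    ∑ u, x u * T.dist u t ≤ T.transportDist x (Pi.single t 1) := by
  have hsingle : (Pi.single t 1 : Fin m → ℝ) ∈ stdSimplex ℝ (Fin m) := single_mem_stdSimplex ℝ t
  obtain ⟨π, hπ, hcost⟩ :=
    T.exists_isCoupling_sum_dist_le hx.1 hsingle.1 (hx.2.trans hsingle.2.symm)
  have hzero : ∀ u v, v ≠ t → π u v = 0 := fun u v hv =>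
    (sum_eq_zero_iff_of_nonneg fun w _ => hπ.nonneg w v).1
      ((hπ.sum_left v).trans (Pi.single_eq_of_ne hv 1)) u (mem_univ u)
  calc ∑ u, x u * T.dist u t = ∑ u, ∑ v, π u v * T.dist u t := by
        simp only [hπ.sum_mul_left fun u => T.dist u t, mul_comm]
    _ = ∑ u, ∑ v, π u v * T.dist u v := sum_congr rfl fun u _ => sum_congr rfl fun v _ => by
        by_cases hv : v = t
        · rw [hv]
        · rw [hzero u v hv, zero_mul, zero_mul]
    _ ≤ T.transportDist x (Pi.single t 1) := hcost

namespace FractionalAlgorithm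

variable {X : FractionalAlgorithm} {P : (s : Situation) → Measure (Fin s.n)}

/-- The transition probabilities `P s` move the mass of `X` from each layer to the next one, at an
expected cost that does not exceed the one accounted for in `X.travelled`. -/
structure IsRealizedBy (X : FractionalAlgorithm) (P : (s : Situation) → Measure (Fin s.n)) :
    Prop where
  sum_mass_mul {m n : ℕ} (T : LayeredTree m) (hn : 0 < n) (parent : Fin n → Fin m)
    (len : Fin n → ℝ≥0) (v : Fin n) :
    ∑ u, X.mass T u * (P ⟨m, T, u, n, hn, parent, len⟩).real {v}
      = X.mass (addLayer T n hn parent len) v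
  sum_dist_le {m n : ℕ} (T : LayeredTree m) (hn : 0 < n) (parent : Fin n → Fin m)
    (len : Fin n → ℝ≥0) :
    ∑ u, ∑ v, X.mass T u * (P ⟨m, T, u, n, hn, parent, len⟩).real {v}
        * (T.dist u (parent v) + len v)
      ≤ T.transportDist (X.mass T) (push parent (X.mass (addLayer T n hn parent len)))
        + ∑ v, len v * X.mass (addLayer T n hn parent len) v

lemma exists_isRealizedBy (X : FractionalAlgorithm) :
    ∃ P : (s : Situation) → Measure (Fin s.n),
      (∀ s, IsProbabilityMeasure (P s)) ∧ X.IsRealizedBy P := by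
  have hplan := fun (m n : ℕ) (T : LayeredTree m) (hn : 0 < n) (parent : Fin n → Fin m)
      (len : Fin n → ℝ≥0) => T.exists_isCoupling_sum_dist_add_le parent len (X.mass_mem T).1
        (X.mass_mem (addLayer T n hn parent len)).1
        ((X.mass_mem T).2.trans (X.mass_mem (addLayer T n hn parent len)).2.symm)
  choose σ hσ hcost using hplan
  choose P hP hPσ using fun s : Situation => exists_isProbabilityMeasure_sum_mul s.hn
    ((hσ s.m s.n s.tree s.hn s.parent s.len).nonneg s.pos)
  have hmass : ∀ {m n : ℕ} (T : LayeredTree m) (hn : 0 < n) (parent : Fin n → Fin m)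
      (len : Fin n → ℝ≥0) (u : Fin m) (v : Fin n),
      X.mass T u * (P ⟨m, T, u, n, hn, parent, len⟩).real {v} = σ m n T hn parent len u v :=
    fun {m n} T hn parent len u v => by
      rw [← (hσ m n T hn parent len).sum_right u]
      exact hPσ ⟨m, T, u, n, hn, parent, len⟩ v
  refine ⟨P, hP, fun {m n} T hn parent len v => ?_, fun {m n} T hn parent len => ?_⟩
  · simpa only [hmass] using (hσ m n T hn parent len).sum_left v
  · simpa only [hmass] using hcost m n T hn parent len

namespace IsRealizedBy

variable [∀ s, IsProbabilityMeasure (P s)] {m : ℕ}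

lemma measureReal_position (h : X.IsRealizedBy P) (T : LayeredTree m) (u : Fin m) :
    (independentDecisions P).real {a | position a T = u} = X.mass T u := by
  induction T with
  | source =>
    have hmass : X.mass source u = 1 := by
      rw [← (X.mass_mem source).2, Fin.sum_univ_one, Subsingleton.elim u 0]
    simp [hmass, Subsingleton.elim _ u]
  | addLayer T n hn parent len ih =>
    rw [← h.sum_mass_mul]
    have hlaw := integral_comp_eq_sum (μ := independentDecisions P)
      (measurable_position (addLayer T n hn parent len)) fun w => if w = u then 1 else 0
    rw [integral_step P T hn parent len fun _ w => if w = u then 1 else 0] at hlaw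
    simpa [ih, Set.preimage] using hlaw.symm

lemma integral_travelled_le (h : X.IsRealizedBy P) (T : LayeredTree m) :
    ∫ a, LayeredTree.travelled a T ∂independentDecisions P ≤ X.travelled T := by
  induction T with
  | source => simp [LayeredTree.travelled, travelled]
  | addLayer T n hn parent len ih =>
    simp only [LayeredTree.travelled]
    rw [integral_add T.integrable_travelled
      (T.integrable_step hn parent len fun u v => T.dist u (parent v) + len v),
      integral_step P T hn parent len fun u v => T.dist u (parent v) + len v]
    simp only [h.measureReal_position]
    exact add_le_add ih (h.sum_dist_le T hn parent len)

lemma integral_cost_le (h : X.IsRealizedBy P) (T : LayeredTree m) (t : Fin m) :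
    ∫ a, LayeredTree.cost a T t ∂independentDecisions P ≤ X.cost T t := by
  simp only [LayeredTree.cost]
  rw [integral_add T.integrable_travelled (T.integrable_dist_position t),
    integral_comp_eq_sum (measurable_position T) fun u => T.dist u t]
  refine add_le_add (h.integral_travelled_le T) ?_
  simpa only [Set.preimage, Set.mem_singleton_iff, h.measureReal_position] using
    T.sum_mul_dist_le_transportDist_single (X.mass_mem T) t

end IsRealizedBy

theorem exists_randAlgorithm (X : FractionalAlgorithm) :
    ∃ A : RandAlgorithm, ∀ {m : ℕ} (T : LayeredTree m) (t : Fin m),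
      ∫ a, LayeredTree.cost a T t ∂(A : Measure DetAlgorithm) ≤ X.cost T t := by
  obtain ⟨P, hP, hXP⟩ := X.exists_isRealizedBy
  exact ⟨⟨independentDecisions P, inferInstance⟩, fun T t => hXP.integral_cost_le T t⟩

end FractionalAlgorithm

lemma length_le_width_mul_depth {m : ℕ} (T : LayeredTree m) (hT : T.UnitLengths) (t : Fin m) :
    T.length ≤ T.width * T.depth t := by
  induction T with
  | source => simp [length, depth]
  | addLayer T n hn parent len ih =>
    have hlength : (addLayer T n hn parent len).length = T.length + n := by
      simp [length, hT.2]
    have hdepth : (addLayer T n hn parent len).depth t = T.depth (parent t) + 1 := by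
      simp [depth, hT.2]
    have hwidth : (T.width : ℝ) ≤ (max T.width n : ℕ) := by gcongr; exact le_max_left _ _
    have hn : (n : ℝ) ≤ (max T.width n : ℕ) := by gcongr; exact le_max_right _ _
    rw [hlength, hdepth, mul_add, mul_one]
    exact add_le_add ((ih hT.1 (parent t)).trans
      (mul_le_mul_of_nonneg_right hwidth (T.depth_nonneg _))) hn

lemma sqrt_length_mul_depth_le {m : ℕ} (T : LayeredTree m) (hT : T.UnitLengths) {w : ℕ}
    (hw : T.width ≤ w) (t : Fin m) : √(T.length * T.depth t) ≤ √w * T.depth t := by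
  have hD := T.depth_nonneg t
  calc √(T.length * T.depth t) ≤ √(w * T.depth t ^ 2) := by
        rw [sq, ← mul_assoc]
        gcongr
        exact (T.length_le_width_mul_depth hT t).trans (by gcongr)
    _ = √w * T.depth t := by rw [Real.sqrt_mul w.cast_nonneg, Real.sqrt_sq hD]

end LayeredTree

lemma mul_sqrt_mul_le_div_add {c L D k : ℝ} (hL : 0 ≤ L) (hD : 0 ≤ D) (hk : 0 < k) :
    c * √(L * D) ≤ 2 * L / k + c ^ 2 / 8 * (k * D) := by
  have hamgm := two_mul_le_add_sq (√(2 * L / k)) (c / 2 * √(k * D / 2))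
  have hprod : √(2 * L / k) * √(k * D / 2) = √(L * D) := by
    rw [← Real.sqrt_mul (by positivity)]
    congr 1
    field_simp
  rw [mul_pow, Real.sq_sqrt (by positivity), Real.sq_sqrt (by positivity)] at hamgm
  calc c * √(L * D) = 2 * √(2 * L / k) * (c / 2 * √(k * D / 2)) := by rw [← hprod]; ring
    _ ≤ 2 * L / k + (c / 2) ^ 2 * (k * D / 2) := hamgm
    _ = 2 * L / k + c ^ 2 / 8 * (k * D) := by ring

theorem mainTheorem2_general :
    ∃ A : LayeredTree.RandAlgorithm, ∀ {m : ℕ} (T : LayeredTree m) (t : Fin m),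
      Integrable (fun a => LayeredTree.cost a T t) (A : Measure LayeredTree.DetAlgorithm) ∧
      ∫ a, LayeredTree.cost a T t ∂(A : Measure LayeredTree.DetAlgorithm)
        ≤ 245 * √(T.length * T.depth t) := by
  obtain ⟨X, hX⟩ := LayeredTree.FractionalAlgorithm.exists_cost_le_sqrt
  obtain ⟨A, hA⟩ := X.exists_randAlgorithm
  exact ⟨A, fun T t => ⟨T.integrable_cost t, (hA T t).trans (hX T t)⟩⟩

theorem mainTheorem2 :
    ∃ (A : ℕ → LayeredTree.RandAlgorithm) (C : ℝ),
      (∀ k : ℕ, 1 ≤ k → ∀ (m : ℕ) (T : LayeredTree m) (t : Fin m),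
        Integrable (fun a => LayeredTree.cost a T t) (A k : Measure LayeredTree.DetAlgorithm) ∧
        ∫ a, LayeredTree.cost a T t ∂(A k : Measure LayeredTree.DetAlgorithm)
          ≤ 2 * T.length / k + C * (k * T.depth t)) ∧
      ∃ C' : ℝ, ∀ (w m : ℕ) (T : LayeredTree m) (t : Fin m), T.UnitLengths → T.width ≤ w →
        Integrable (fun a => LayeredTree.cost a T t)
          (A ⌊√(w : ℝ)⌋₊ : Measure LayeredTree.DetAlgorithm) ∧
        ∫ a, LayeredTree.cost a T t ∂(A ⌊√(w : ℝ)⌋₊ : Measure LayeredTree.DetAlgorithm)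
          ≤ C' * (√(w : ℝ) * T.depth t) := by
  obtain ⟨A, hA⟩ := mainTheorem2_general
  refine ⟨fun _ => A, 245 ^ 2 / 8, fun k hk m T t => ⟨(hA T t).1, ?_⟩,
    245, fun w m T t hT hw => ⟨(hA T t).1, ?_⟩⟩
  · exact (hA T t).2.trans
      (mul_sqrt_mul_le_div_add ((T.depth_nonneg t).trans (T.depth_le_length t)) (T.depth_nonneg t)
        (Nat.cast_pos.2 hk))
  · exact (hA T t).2.trans
      (mul_le_mul_of_nonneg_left (T.sqrt_length_mul_depth_le hT hw t) (by norm_num))
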